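/- **Setting.** Let $\mathbf h_1,\dots,\mathbf h_K\in\mathbb C^M$ be channel vectors, $\bar\gamma_k>0$ SINR targets, $\sigma_k^2>0$ noise variances, $\bar C_m>0$ fronthaul capacities, and $\eta_m=2^{\bar C_m}$. Write $\mathbf e_m$ for the unit vectors, $\mathbf E_m=\mathbf e_m\mathbf e_m^\dagger$, and $\mathbf A^{(i:j,k:l)}$ for submatrices; vectors are compared componentwise. The semidefinite relaxation (SDR) of the joint beamforming and compression problem is to minimize $\sum_k\mathrm{tr}(\mathbf V_k)+\mathrm{tr}(\mathbf Q)$ over positive semidefinite $M\times M$ matrices $\mathbf V_1,\dots,\mathbf V_K,\mathbf Q$ subject to $a_k\ge 0$ for all $k$ and $\mathbf B_m\succeq\mathbf 0$ for all $m$, where $$a_k=\tfrac1{\bar\gamma_k}\mathbf h_k^\dagger\mathbf V_k\mathbf h_k-\sum_{j\ne k}\mathbf h_k^\dagger\mathbf V_j\mathbf h_k-\mathbf h_k^\dagger\mathbf Q\mathbf h_k-\sigma_k^2,\qquad \mathbf B_m=\eta_m\begin{bmatrix}\mathbf 0&\mathbf 0\\ \mathbf 0&\mathbf Q^{(m:M,m:M)}\end{bmatrix}-\Big(\sum_k\mathbf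 V_k^{(m,m)}+\mathbf Q^{(m,m)}\Big)\mathbf E_m .$$ It is *strictly feasible* if there are $\mathbf V_k\succ\mathbf 0$, $\mathbf Q\succ\mathbf 0$ with $a_k>0$ for all $k$ and $\mathbf B_m^{(m:M,m:M)}\succ\mathbf 0$ for all $m$ (outside of this block $\mathbf B_m$ vanishes identically). *Dual mapping.* For $\boldsymbol\beta\in\mathbb R_+^K$ let $\mathbf\Gamma_1=\mathbf I+\sum_k\beta_k\mathbf h_k\mathbf h_k^\dagger$ and, for $m=1,\dots,M$, let $\mathbf\Lambda_m=\mathbf\Lambda_m(\boldsymbol\beta)$ be zero except for $$\mathbf\Lambda_m^{(m:M,m:M)}=\begin{bmatrix}\frac1{\eta_m-1}\mathbf\Gamma_m^{(m,m)}&\frac1{\eta_m}\mathbf\Gamma_m^{(m,m+1:M)}\\ \frac1{\eta_m}\mathbf\Gamma_m^{(m+1:M,m)}&\frac{\eta_m-1}{\eta_m^2}\frac{\mathbf\Gamma_m^{(m+1:M,m)}\mathbf\Gamma_m^{(m,m+1:M)}}{\mathbf\Gamma_m^{(m,m)}}\end{bmatrix},\qquad \mathbf\Gamma_{m+1}=\mathbf\Gamma_m-\eta_m\mathbf\Lambda_m+\mathbf\Lambda_m^{(m,m)}\mathbf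 E_m .$$ Let $\mathbf C_k(\boldsymbol\beta)=\mathbf I+\sum_{j\ne k}\beta_j\mathbf h_j\mathbf h_j^\dagger+\sum_m\mathbf\Lambda_m^{(m,m)}(\boldsymbol\beta)\mathbf E_m$, $I_k(\boldsymbol\beta)=\bar\gamma_k/(\mathbf h_k^\dagger\mathbf C_k(\boldsymbol\beta)^{-1}\mathbf h_k)$, $I=(I_1,\dots,I_K)$ and $\lambda(\boldsymbol\beta)=\max_k\|\mathbf C_k(\boldsymbol\beta)-\mathbf I\|_2$. *Primal mapping* (for given $\boldsymbol\beta$). Let $\hat{\mathbf v}_k=\mathbf C_k(\boldsymbol\beta)^{-1}\mathbf h_k/\|\mathbf C_k(\boldsymbol\beta)^{-1}\mathbf h_k\|$, $\hat{\mathbf V}_k=\hat{\mathbf v}_k\hat{\mathbf v}_k^\dagger$, and $\mathbf\Lambda_m(\boldsymbol\beta)=\boldsymbol\lambda_m\boldsymbol\lambda_m^\dagger$. For $\mathbf p\in\mathbb R_+^K$ let $\mathbf Q=\mathbf Q(\mathbf p)$ be the Hermitian matrix computed for $m=M,M-1,\dots,1$ by $$\mathbf Q^{(m+1:M,m)}=-\frac{\mathbf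 Q^{(m+1:M,m+1:M)}\boldsymbol\lambda_m^{(m+1:M)}}{\boldsymbol\lambda_m^{(m)}},\qquad \mathbf Q^{(m,m)}=\frac{\eta_m}{\eta_m-1}\frac{(\boldsymbol\lambda_m^{(m+1:M)})^\dagger\mathbf Q^{(m+1:M,m+1:M)}\boldsymbol\lambda_m^{(m+1:M)}}{|\boldsymbol\lambda_m^{(m)}|^2}+\frac{1}{\eta_m-1}\sum_kp_k\hat{\mathbf V}_k^{(m,m)},$$ where the terms with $\boldsymbol\lambda_m^{(m+1:M)}$ are absent for $m=M$. Let $$J_k(\mathbf p)=\frac{\bar\gamma_k\big(\sum_{j\ne k}p_j\mathbf h_k^\dagger\hat{\mathbf V}_j\mathbf h_k+\mathbf h_k^\dagger\mathbf Q(\mathbf p)\mathbf h_k+\sigma_k^2\big)}{\mathbf h_k^\dagger\hat{\mathbf V}_k\mathbf h_k},\qquad G_{kj}=\frac{\bar\gamma_k\big([j\ne k]\,\mathbf h_k^\dagger\hat{\mathbf V}_j\mathbf h_k+\mathbf h_k^\dagger\mathbf Q(\mathbf e_j)\mathbf h_k\big)}{\mathbf h_k^\dagger\hat{\mathbf V}_k\mathbf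 h_k},$$ and $J=(J_1,\dots,J_K)$. A mapping $f:\mathbb R_+^K\to\mathbb R^K$ is a *standard interference mapping* if $f(\mathbf x)\ge\mathbf 0$ for all $\mathbf x\ge\mathbf 0$; $f_k(\alpha\mathbf x)<\alpha f_k(\mathbf x)$ for all $k$, all $\alpha>1$ and all $\mathbf x\ge\mathbf 0$, $\mathbf x\ne\mathbf 0$; and $f(\mathbf x)\ge f(\mathbf y)$ whenever $\mathbf x\ge\mathbf y\ge\mathbf 0$. Thompson's metric on $\mathbb R_{++}^K$ is $\mu(\mathbf x,\mathbf y)=\max_k|\log(x_k/y_k)|$. A sequence $\mathbf x^{(i)}$ converges linearly to $\mathbf x$ if $\|\mathbf x^{(i)}-\mathbf x\|\le A r^i$ for all $i$, with some $A$ and some $0\le r<1$. **Theorem.** Suppose that the SDR is strictly feasible. 1. $I$ is a standard interference mapping, and it has exactly one fixed point $\boldsymbol\beta^*$ in $\mathbb R_+^K$; this fixed point is positive. $I$ is contractive in Thompson's metric: $\mu(I(\boldsymbol\beta),I(\tilde{\boldsymbol\beta}))<\mu(\boldsymbol\beta,\tilde{\boldsymbol\beta})$ for all $\boldsymbol\beta\ne\tilde{\boldsymbol\beta}$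 in $\mathbb R_{++}^K$. For every $\boldsymbol\beta^{(0)}\in\mathbb R_+^K$ the dual iteration $\boldsymbol\beta^{(i+1)}=I(\boldsymbol\beta^{(i)})$ converges linearly to $\boldsymbol\beta^*$; moreover there is $c\in[0,1)$ (depending on $\boldsymbol\beta^{(0)}$) with $\mu(\boldsymbol\beta^{(i+1)},\boldsymbol\beta^*)\le c\,\mu(\boldsymbol\beta^{(i)},\boldsymbol\beta^*)$ for all $i\ge1$, and $$\limsup_{i\to\infty}\frac{\mu(\boldsymbol\beta^{(i+1)},\boldsymbol\beta^*)}{\mu(\boldsymbol\beta^{(i)},\boldsymbol\beta^*)}\le\frac{\lambda(\boldsymbol\beta^*)}{1+\lambda(\boldsymbol\beta^*)}$$ (a quotient $0/0$ is read as $0$). 2. Let $J$ and $\mathbf G$ be formed with $\boldsymbol\beta=\boldsymbol\beta^*$. Then $J$ is a standard interference mapping, $\mathbf G$ is entrywise nonnegative, $J(\mathbf p)=\mathbf G\mathbf p+J(\mathbf 0)$, and the spectral radius satisfies $\rho(\mathbf G)<1$. $J$ has exactly one fixed point $\mathbf p^*$ in $\mathbb R_+^K$; it is positive, and for every $\mathbf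 p^{(0)}\in\mathbb R_+^K$ the primal iteration $\mathbf p^{(i+1)}=J(\mathbf p^{(i)})$ converges linearly to $\mathbf p^*$. Its rate is $\rho(\mathbf G)$: for every $r>\rho(\mathbf G)$ there is $A$ with $\|\mathbf p^{(i)}-\mathbf p^*\|\le A r^i\|\mathbf p^{(0)}-\mathbf p^*\|$ for all $i$ and all $\mathbf p^{(0)}\in\mathbb R_+^K$, and there is a $\mathbf p^{(0)}\in\mathbb R_+^K$ with $\|\mathbf p^{(i)}-\mathbf p^*\|^{1/i}\to\rho(\mathbf G)$. -/

import Mathlib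

open Filter Topology Matrix
open scoped ComplexOrder

noncomputable section

/-- A mapping on vectors is a standard interference mapping if, on the nonnegative orthant, it is
nonnegative, strictly subhomogeneous and monotone (all orders are componentwise). -/
structure IsStandardInterference {n : ℕ} (f : (Fin n → ℝ) → (Fin n → ℝ)) : Prop where
  nonneg : ∀ x, 0 ≤ x → 0 ≤ f x
  strictSubhomogeneous : ∀ a : ℝ, 1 < a → ∀ x, 0 ≤ x → x ≠ 0 → ∀ k, f (a • x) k < a * f x k
  monotone : ∀ x y, 0 ≤ y → y ≤ x → f y ≤ f x

/-- Thompson's metric on positive vectors, `max_k |log (x_k / y_k)|`. -/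
def thompson {n : ℕ} (x y : Fin n → ℝ) : ℝ := ⨆ k, |Real.log (x k / y k)|

/-- Linear (geometric) convergence of `x` to `a`. The choice of the norm does not matter. -/
def ConvergesLinearly {n : ℕ} (x : ℕ → Fin n → ℝ) (a : Fin n → ℝ) : Prop :=
  ∃ A r : ℝ, 0 ≤ r ∧ r < 1 ∧ ∀ i, ‖x i - a‖ ≤ A * r ^ i

/-- The (real) value of the Hermitian form `h† A h`. -/
def hform {n : ℕ} (A : Matrix (Fin n) (Fin n) ℂ) (h : Fin n → ℂ) : ℝ := (star h ⬝ᵥ A *ᵥ h).re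

/-- Data of the joint beamforming and compression problem with `M` relays and `K` users. -/
structure Network (M K : ℕ) where
  /-- channel vectors `h_k` -/
  h : Fin K → Fin M → ℂ
  /-- SINR targets -/
  γ : Fin K → ℝ
  /-- noise standard deviations, so that the noise variance of user `k` is `σ k ^ 2` -/
  σ : Fin K → ℝ
  /-- fronthaul capacities -/
  C : Fin M → ℝ

namespace Network

variable {M K : ℕ} (N : Network M K)

/-- `2 ^ C_m`. -/
def η (m : Fin M) : ℝ := (2 : ℝ) ^ (N.C m)

/-- The matrix `h_k h_k†`. -/
def hh (k : Fin K) : Matrix (Fin M) (Fin M) ℂ := vecMulVec (N.h k) (star (N.h k))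

/-! ### The semidefinite relaxation -/

/-- The SINR constraint function `a_k`. -/
def a (V : Fin K → Matrix (Fin M) (Fin M) ℂ) (Q : Matrix (Fin M) (Fin M) ℂ) (k : Fin K) : ℝ :=
  1 / N.γ k * hform (V k) (N.h k) - ∑ j ∈ Finset.univ.erase k, hform (V j) (N.h k)
    - hform Q (N.h k) - N.σ k ^ 2

/-- The fronthaul constraint matrix `B_m`; its rows and columns with index `< m` vanish. -/
def B (V : Fin K → Matrix (Fin M) (Fin M) ℂ) (Q : Matrix (Fin M) (Fin M) ℂ) (m : Fin M) :
    Matrix (Fin M) (Fin M) ℂ :=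
  (N.η m : ℂ) • (Matrix.of fun i j => if m ≤ i ∧ m ≤ j then Q i j else 0)
    - Matrix.single m m (∑ k, V k m m + Q m m)

/-- Strict feasibility (Slater's condition) of the semidefinite relaxation. Since `B_m` is zero
outside of its block with row and column indices `≥ m`, its strict positivity is
that of this block. -/
def StrictlyFeasible : Prop :=
  ∃ (V : Fin K → Matrix (Fin M) (Fin M) ℂ) (Q : Matrix (Fin M) (Fin M) ℂ),
    (∀ k, (V k).PosDef) ∧ Q.PosDef ∧ (∀ k, 0 < N.a V Q k) ∧
    ∀ m, ((N.B V Q m).submatrix (Subtype.val : {i : Fin M // m ≤ i} → Fin M)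
      (Subtype.val : {i : Fin M // m ≤ i} → Fin M)).PosDef

/-! ### The dual fixed point iteration -/

/-- `Γ(β) = I + ∑ β_k h_k h_k†`. -/
def Γ (β : Fin K → ℝ) : Matrix (Fin M) (Fin M) ℂ := 1 + ∑ k, (β k : ℂ) • N.hh k

/-- The rank one matrix `Λ_m` computed from the residual matrix `Γ_m` (here `G`). -/
def lambdaOf (m : Fin M) (G : Matrix (Fin M) (Fin M) ℂ) : Matrix (Fin M) (Fin M) ℂ :=
  Matrix.of fun i j =>
    if i < m ∨ j < m then 0
    else if i = m ∧ j = m then 1 / ((N.η m : ℂ) - 1) * G m m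
    else if i = m then 1 / (N.η m : ℂ) * G m j
    else if j = m then 1 / (N.η m : ℂ) * G i m
    else ((N.η m : ℂ) - 1) / (N.η m : ℂ) ^ 2 * (G i m * G m j / G m m)

/-- The residual matrices: start with `Γ(β)` and, for each relay in turn, subtract
the contribution `2 ^ C_m Λ_m - Λ_m^{(m,m)} E_m` of `Λ_m`. -/
def residual (β : Fin K → ℝ) : ℕ → Matrix (Fin M) (Fin M) ℂ
  | 0 => N.Γ β
  | n + 1 =>
    if hn : n < M then
      residual β n - ((N.η ⟨n, hn⟩ : ℂ) • N.lambdaOf ⟨n, hn⟩ (residual β n)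
        - Matrix.single ⟨n, hn⟩ ⟨n, hn⟩ (N.lambdaOf ⟨n, hn⟩ (residual β n) ⟨n, hn⟩ ⟨n, hn⟩))
    else residual β n

/-- `Λ_m(β)`. -/
def Λ (β : Fin K → ℝ) (m : Fin M) : Matrix (Fin M) (Fin M) ℂ :=
  N.lambdaOf m (N.residual β m)

/-- `C_k(β, {Λ_m(β)}) = I + ∑_{j ≠ k} β_j h_j h_j† + ∑_m Λ_m(β)^{(m,m)} E_m`. -/
def Cmat (β : Fin K → ℝ) (k : Fin K) : Matrix (Fin M) (Fin M) ℂ :=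
  1 + ∑ j ∈ Finset.univ.erase k, (β j : ℂ) • N.hh j + ∑ m, Matrix.single m m (N.Λ β m m m)

/-- The dual mapping `I_k(β) = γ_k / (h_k† C_k(β)⁻¹ h_k)`. -/
def dualMap (β : Fin K → ℝ) : Fin K → ℝ :=
  fun k => N.γ k / hform (N.Cmat β k)⁻¹ (N.h k)

/-- `λ(β) = max_k ‖C_k(β) - I‖₂`, with the spectral norm. -/
def lam (β : Fin K → ℝ) : ℝ :=
  ⨆ k, ‖Matrix.toEuclideanCLM (n := Fin M) (𝕜 := ℂ) (N.Cmat β k - 1)‖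

/-! ### The primal fixed point iteration, for given dual variables `β` and `Λ_m(β)` -/

/-- The unit vector `v̂_k = C_k⁻¹ h_k / ‖C_k⁻¹ h_k‖` (Euclidean norm). -/
def vhat (β : Fin K → ℝ) (k : Fin K) : Fin M → ℂ :=
  ((‖WithLp.toLp 2 ((N.Cmat β k)⁻¹ *ᵥ N.h k)‖⁻¹ : ℝ) : ℂ) • ((N.Cmat β k)⁻¹ *ᵥ N.h k)

/-- `V̂_k = v̂_k v̂_k†`. -/
def Vhat (β : Fin K → ℝ) (k : Fin K) : Matrix (Fin M) (Fin M) ℂ :=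
  vecMulVec (N.vhat β k) (star (N.vhat β k))

/-- The vector `λ_m` in `Λ_m(β) = λ_m λ_m†`, normalized by `λ_m^{(m)} > 0`
(`Q(p)` below does not change if `λ_m` is multiplied by a phase). -/
def lamVec (β : Fin K → ℝ) (m : Fin M) : Fin M → ℂ :=
  fun i => N.Λ β m i m / ((Real.sqrt (N.Λ β m m m).re : ℝ) : ℂ)

/-- The part of `λ_m` with indices `> m`. -/
def lamTail (β : Fin K → ℝ) (m : Fin M) : Fin M → ℂ :=
  fun i => if m < i then N.lamVec β m i else 0

/-- One step of the solution of `B_m λ_m = 0`: given `Q` on the indices `> m`, compute its entries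
on the indices `≥ m`. -/
def Qstep (β p : Fin K → ℝ) (m : Fin M) (Q : Matrix (Fin M) (Fin M) ℂ) :
    Matrix (Fin M) (Fin M) ℂ :=
  Matrix.of fun i j =>
    if m < i ∧ m < j then Q i j
    else if m < i ∧ j = m then -((Q *ᵥ N.lamTail β m) i / N.lamVec β m m)
    else if i = m ∧ m < j then star (-((Q *ᵥ N.lamTail β m) j / N.lamVec β m m))
    else if i = m ∧ j = m then
      (N.η m : ℂ) / ((N.η m : ℂ) - 1) * ((star (N.lamTail β m) ⬝ᵥ Q *ᵥ N.lamTail β m)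
          / ((‖N.lamVec β m m‖ ^ 2 : ℝ) : ℂ))
        + 1 / ((N.η m : ℂ) - 1) * ∑ k, (p k : ℂ) * N.Vhat β k m m
    else 0

/-- The lower right `n × n` block of `Q(p)` (zero elsewhere), from the last relay to the first. -/
def Qrec (β p : Fin K → ℝ) : ℕ → Matrix (Fin M) (Fin M) ℂ
  | 0 => 0
  | n + 1 =>
    if hn : n < M then N.Qstep β p (Fin.rev ⟨n, hn⟩) (Qrec β p n) else Qrec β p n

/-- `Q(p)`. -/
def Qmat (β p : Fin K → ℝ) : Matrix (Fin M) (Fin M) ℂ := N.Qrec β p M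

/-- The primal mapping `J_k(p)`. -/
def primalMap (β p : Fin K → ℝ) : Fin K → ℝ := fun k =>
  N.γ k * (∑ j ∈ Finset.univ.erase k, p j * hform (N.Vhat β j) (N.h k)
      + hform (N.Qmat β p) (N.h k) + N.σ k ^ 2) / hform (N.Vhat β k) (N.h k)

/-- The matrix `G` of the primal mapping; `Pi.single j 1` is the unit vector `e_j`. -/
def G (β : Fin K → ℝ) : Matrix (Fin K) (Fin K) ℝ := Matrix.of fun k j =>
  if j = k then
    N.γ k * hform (N.Qmat β (Pi.single j 1)) (N.h k) / hform (N.Vhat β k) (N.h k)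
  else
    N.γ k * (hform (N.Vhat β j) (N.h k) + hform (N.Qmat β (Pi.single j 1)) (N.h k))
      / hform (N.Vhat β k) (N.h k)

/-- The spectral radius of `G` (over the complex numbers). -/
def rhoG (β : Fin K → ℝ) : ENNReal :=
  spectralRadius ℂ ((N.G β).map (algebraMap ℝ ℂ))

end Network

end

/-!
Everything is read off from Hermitian forms. One elimination step `Γ_m ↦ Γ_{m+1}` is a convex
combination of truncation and Schur complement, so that the form of `Γ_{m+1}` is a minimum of
nonnegative combinations of values of the form of `Γ_m` (`Network.hform_residualStep`). Hence the
residual matrices, and with them `Λ_m(β)^{(m,m)}` and `C_k(β) - I`, are monotone and subhomogeneous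
in `β` for the Loewner order (`Network.hform_residual_le`, `Network.hform_Cmat_le`). Since
`C_k(β) ≼ (1 + λ(β)) I`, the identity summand of `C_k` turns this into the quantitative bound
`I(t β) ≤ (1 + t λ(β)) / (1 + λ(β)) I(β)` for `t ≥ 1` (`Network.dualMap_le`). It makes `I` a standard
interference mapping that is contractive in Thompson's metric `μ`, and at a fixed point it bounds
`μ(I(β), β*)` by `θ(μ(β, β*)) μ(β, β*)` with `θ(s) = λ e^s / (1 + λ e^s)`, by the weighted
inequality between the arithmetic and the geometric mean (`log_rate_le`). The factor `θ` is
increasing and below `1`, and `θ(0) = λ / (1 + λ)`: this is linear convergence with the stated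
asymptotic rate.

A fixed point exists because the iterates from `0` increase and satisfy `β ≤ I(β)`. Such `β` are
dual feasible, and weak duality with a feasible point of the relaxation bounds `∑ β_k σ_k²`
(`Network.sum_mul_sq_le`).

For the primal mapping, the recursion for `Q(p)` is a congruence plus a nonnegative multiple of
`E_m`; thus `Q(p)` is linear in `p`, positive semidefinite for `p ≥ 0`, and satisfies
`λ_m† B_m λ_m = 0` (`Network.complementary_slackness`). Weak duality therefore holds with equality
along this family, which says that `wᵀ (p - G p) = ∑ p_k + tr Q(p)` for the positive vector
`w_k = β_k h_k† V̂_k h_k / γ_k` (`Network.sum_weight_mulVec_le`). So `G` contracts a weighted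
`ℓ¹`-norm, and `ρ(G) < 1`. As `G` is nonnegative, the maximum norm of `Gⁱ 1` is the operator norm
of `Gⁱ`, so Gelfand's formula gives the rate `ρ(G)` and shows that it is attained from `p* + 1`.
-/

/-! ### Hermitian forms -/

section HermitianForm

variable {n : ℕ}

lemma hform_add (A B : Matrix (Fin n) (Fin n) ℂ) (x : Fin n → ℂ) :
    hform (A + B) x = hform A x + hform B x := by
  simp [hform, add_mulVec, dotProduct_add]

lemma hform_sub (A B : Matrix (Fin n) (Fin n) ℂ) (x : Fin n → ℂ) :
    hform (A - B) x = hform A x - hform B x := by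
  simp [hform, sub_mulVec, dotProduct_sub]

lemma hform_smul (r : ℝ) (A : Matrix (Fin n) (Fin n) ℂ) (x : Fin n → ℂ) :
    hform ((r : ℂ) • A) x = r * hform A x := by
  simp [hform, smul_mulVec, dotProduct_smul]

@[simp] lemma hform_zero (x : Fin n → ℂ) : hform 0 x = 0 := by
  simp [hform]

lemma hform_sum {ι : Type*} (s : Finset ι) (A : ι → Matrix (Fin n) (Fin n) ℂ) (x : Fin n → ℂ) :
    hform (∑ i ∈ s, A i) x = ∑ i ∈ s, hform (A i) x := by
  classical
  induction s using Finset.induction_on with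
  | empty => simp
  | insert a s ha ih => rw [Finset.sum_insert ha, Finset.sum_insert ha, hform_add, ih]

lemma hform_one (x : Fin n → ℂ) : hform 1 x = ∑ i, ‖x i‖ ^ 2 := by
  simp [hform, dotProduct, ← Complex.normSq_eq_norm_sq, Complex.normSq_apply]

lemma hform_vecMulVec (v x : Fin n → ℂ) :
    hform (vecMulVec v (star v)) x = ‖star v ⬝ᵥ x‖ ^ 2 := by
  have h : star x ⬝ᵥ v = star (star v ⬝ᵥ x) := star_dotProduct x v
  rw [hform, vecMulVec_mulVec, op_smul_eq_smul, dotProduct_smul, h, smul_eq_mul,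
    ← Complex.normSq_eq_norm_sq, Complex.normSq_apply]
  simp

lemma hform_single (m : Fin n) (c : ℂ) (x : Fin n → ℂ) :
    hform (Matrix.single m m c) x = c.re * ‖x m‖ ^ 2 := by
  have : star (x m) * (c * x m) = c * (Complex.normSq (x m) : ℂ) := by
    rw [Complex.normSq_eq_conj_mul_self]; simp; ring
  rw [hform, Matrix.single_mulVec, dotProduct_comm]
  simp only [Function.update_apply, dotProduct, Pi.zero_apply, Pi.star_apply]
  rw [Finset.sum_eq_single m (by intro b _ hb; simp [hb]) (by simp)]
  rw [if_pos rfl, mul_comm, this, ← Complex.normSq_eq_norm_sq]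
  simp

lemma hform_single_vec (A : Matrix (Fin n) (Fin n) ℂ) (m : Fin n) :
    hform A (Pi.single m 1) = (A m m).re := by
  simp [hform, Pi.star_single]

lemma hform_conj (A B : Matrix (Fin n) (Fin n) ℂ) (x : Fin n → ℂ) :
    hform (Bᴴ * A * B) x = hform A (B *ᵥ x) := by
  simp only [hform, star_mulVec, ← mulVec_mulVec, dotProduct_mulVec, vecMul_vecMul]

lemma hform_smul_vec (A : Matrix (Fin n) (Fin n) ℂ) (c : ℂ) (x : Fin n → ℂ) :
    hform A (c • x) = ‖c‖ ^ 2 * hform A x := by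
  have : star c * c = ((‖c‖ ^ 2 : ℝ) : ℂ) := by
    rw [← Complex.normSq_eq_norm_sq, Complex.normSq_eq_conj_mul_self]; rfl
  rw [hform, star_smul, mulVec_smul, smul_dotProduct, dotProduct_smul, smul_smul, this, hform,
    smul_eq_mul, Complex.re_ofReal_mul]

lemma Matrix.IsHermitian.star_dotProduct_mulVec_comm {A : Matrix (Fin n) (Fin n) ℂ}
    (hA : A.IsHermitian) (x y : Fin n → ℂ) :
    star y ⬝ᵥ A *ᵥ x = star (star x ⬝ᵥ A *ᵥ y) := by
  rw [← star_dotProduct_star, star_star, star_mulVec, hA.eq, dotProduct_comm,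
    ← dotProduct_mulVec, dotProduct_comm]

lemma Matrix.IsHermitian.ofReal_hform {A : Matrix (Fin n) (Fin n) ℂ} (hA : A.IsHermitian)
    (x : Fin n → ℂ) : star x ⬝ᵥ A *ᵥ x = (hform A x : ℂ) := by
  have := hA.star_dotProduct_mulVec_comm x x
  rw [hform]
  exact (Complex.conj_eq_iff_re.1 this.symm).symm

lemma Matrix.IsHermitian.hform_add_vec {A : Matrix (Fin n) (Fin n) ℂ} (hA : A.IsHermitian)
    (x y : Fin n → ℂ) :
    hform A (x + y) = hform A x + 2 * (star y ⬝ᵥ A *ᵥ x).re + hform A y := by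
  have := hA.star_dotProduct_mulVec_comm y x
  rw [hform, star_add, mulVec_add, add_dotProduct, dotProduct_add, dotProduct_add, this]
  simp [hform]; ring

lemma Matrix.PosSemidef.hform_nonneg {A : Matrix (Fin n) (Fin n) ℂ} (hA : A.PosSemidef)
    (x : Fin n → ℂ) : 0 ≤ hform A x :=
  (Complex.nonneg_iff.1 (hA.dotProduct_mulVec_nonneg x)).1

lemma Matrix.PosDef.hform_pos {A : Matrix (Fin n) (Fin n) ℂ} (hA : A.PosDef)
    {x : Fin n → ℂ} (hx : x ≠ 0) : 0 < hform A x :=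
  (Complex.pos_iff.1 (hA.dotProduct_mulVec_pos hx)).1

lemma Matrix.IsHermitian.posSemidef_of_hform {A : Matrix (Fin n) (Fin n) ℂ} (hA : A.IsHermitian)
    (h : ∀ x, 0 ≤ hform A x) : A.PosSemidef :=
  .of_dotProduct_mulVec_nonneg hA fun x => by
    rw [hA.ofReal_hform]; exact_mod_cast h x

lemma Matrix.IsHermitian.posDef_of_hform {A : Matrix (Fin n) (Fin n) ℂ} (hA : A.IsHermitian)
    (h : ∀ x, x ≠ 0 → 0 < hform A x) : A.PosDef :=
  .of_dotProduct_mulVec_pos hA fun x hx => by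
    rw [hA.ofReal_hform]; exact_mod_cast h x hx

/-- The Cauchy–Schwarz inequality `|x† h|² ≤ (h† A⁻¹ h) (x† A x)`. -/
lemma Matrix.PosDef.norm_dotProduct_sq_le {A : Matrix (Fin n) (Fin n) ℂ} (hA : A.PosDef)
    (x h : Fin n → ℂ) : ‖star x ⬝ᵥ h‖ ^ 2 ≤ hform A⁻¹ h * hform A x := by
  rcases eq_or_ne x 0 with rfl | hx
  · simp [hform]
  have hdet : IsUnit A.det := (isUnit_iff_isUnit_det _).1 hA.isUnit
  have hpos := hA.hform_pos hx
  set q := hform A x with hq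
  set y := A⁻¹ *ᵥ h with hy
  set c := star x ⬝ᵥ h with hc
  have hAy : A *ᵥ y = h := by rw [hy, mulVec_mulVec, mul_nonsing_inv _ hdet, one_mulVec]
  have hyy : hform A y = hform A⁻¹ h := by
    rw [hform, hAy, star_dotProduct, hform, ← hy]; simp
  -- the minimizer over `s` of the nonnegative quadratic `h_A(y + s x)`
  have h0 := hA.posSemidef.hform_nonneg (y + (-(c / q)) • x)
  have h1 : (star (-(c / (q : ℂ)) • x) ⬝ᵥ A *ᵥ y).re = -(‖c‖ ^ 2 / q) := by
    rw [hAy, star_smul, smul_dotProduct, ← hc, smul_eq_mul, star_neg, star_div₀, neg_mul,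
      div_mul_eq_mul_div, Complex.neg_re]
    have : star c * c = ((‖c‖ ^ 2 : ℝ) : ℂ) := by
      rw [← Complex.normSq_eq_norm_sq, Complex.normSq_eq_conj_mul_self]; rfl
    rw [this]
    have : star (q : ℂ) = q := Complex.conj_ofReal q
    rw [this, ← Complex.ofReal_div, Complex.ofReal_re]
  rw [hA.isHermitian.hform_add_vec, h1, hyy, hform_smul_vec, ← hq, norm_neg, norm_div,
    Complex.norm_real, Real.norm_of_nonneg hpos.le] at h0
  have h2 : ‖c‖ ^ 2 / q ≤ hform A⁻¹ h := by
    have : (‖c‖ / q) ^ 2 * q = ‖c‖ ^ 2 / q := by field_simp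
    linarith
  rwa [div_le_iff₀ hpos] at h2

lemma Matrix.PosDef.hform_mulVec_inv {A : Matrix (Fin n) (Fin n) ℂ} (hA : A.PosDef)
    (h : Fin n → ℂ) : hform A (A⁻¹ *ᵥ h) = hform A⁻¹ h := by
  have hdet : IsUnit A.det := (isUnit_iff_isUnit_det _).1 hA.isUnit
  rw [hform, mulVec_mulVec, mul_nonsing_inv _ hdet, one_mulVec, star_dotProduct, hform]
  simp

/-- Inversion reverses the Loewner order, up to a scalar factor. -/
lemma Matrix.PosDef.hform_inv_le {A B : Matrix (Fin n) (Fin n) ℂ} (hA : A.PosDef)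
    (hB : B.PosDef) {t : ℝ} (hAB : ∀ x, hform A x ≤ t * hform B x) (h : Fin n → ℂ) :
    hform B⁻¹ h ≤ t * hform A⁻¹ h := by
  have h0 := hA.inv.posSemidef.hform_nonneg h
  have hcs := hA.norm_dotProduct_sq_le (B⁻¹ *ᵥ h) h
  have hb : star (B⁻¹ *ᵥ h) ⬝ᵥ h = (hform B⁻¹ h : ℂ) := by
    rw [star_dotProduct, hB.inv.isHermitian.ofReal_hform]; exact Complex.conj_ofReal _
  have h1 := hAB (B⁻¹ *ᵥ h)
  rw [hB.hform_mulVec_inv] at h1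
  rw [hb, Complex.norm_real, Real.norm_eq_abs, sq_abs] at hcs
  rcases (hB.inv.posSemidef.hform_nonneg h).eq_or_lt with hz | hz
  · rw [← hz]
    rcases eq_or_ne h 0 with rfl | hh
    · simp [hform]
    · exact absurd hz (hB.inv.hform_pos hh).ne
  · have := hcs.trans (mul_le_mul_of_nonneg_left h1 h0)
    nlinarith

end HermitianForm

/-! ### The residual matrices -/

/-- `A` is Hermitian, vanishes outside of the block with row and column indices `≥ n`, and is
positive definite on that block. -/
structure IsTailPosDef {M : ℕ} (n : ℕ) (A : Matrix (Fin M) (Fin M) ℂ) : Prop where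
  isHermitian : A.IsHermitian
  apply_eq_zero : ∀ i j : Fin M, (i.val < n ∨ j.val < n) → A i j = 0
  hform_pos : ∀ x : Fin M → ℂ, (∀ i : Fin M, i.val < n → x i = 0) → x ≠ 0 → 0 < hform A x

/-- The projection onto the coordinates with index `> m`. -/
noncomputable def tailProj {M : ℕ} (m : Fin M) : Matrix (Fin M) (Fin M) ℂ :=
  diagonal fun i => if m < i then 1 else 0

section TailPosDef

variable {M : ℕ} {A : Matrix (Fin M) (Fin M) ℂ}

lemma tailProj_conjTranspose (m : Fin M) : (tailProj m)ᴴ = tailProj m := by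
  rw [tailProj, diagonal_conjTranspose]
  congr 1
  ext i
  simp only [Pi.star_apply]
  split_ifs <;> simp

lemma tailProj_mulVec_apply (m : Fin M) (x : Fin M → ℂ) (i : Fin M) :
    (tailProj m *ᵥ x) i = if m < i then x i else 0 := by
  simp [tailProj, mulVec_diagonal]

lemma IsTailPosDef.ofReal_re_diag {n : ℕ} (hA : IsTailPosDef n A) (i : Fin M) :
    ((A i i).re : ℂ) = A i i :=
  Complex.conj_eq_iff_re.1 (hA.isHermitian.apply i i)

lemma IsTailPosDef.diag_pos {m : Fin M} (hA : IsTailPosDef m A) : 0 < (A m m).re := by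
  rw [← hform_single_vec]
  refine hA.hform_pos _ (fun i hi => Pi.single_eq_of_ne (fun h => ?_) _) (by simp)
  rw [h] at hi
  exact lt_irrefl _ hi

end TailPosDef

namespace Network

variable {M K : ℕ} (N : Network M K)

/-- The passage from the residual matrix `Γ_m` to `Γ_{m+1}`. -/
noncomputable def residualStep (m : Fin M) (A : Matrix (Fin M) (Fin M) ℂ) :
    Matrix (Fin M) (Fin M) ℂ :=
  A - ((N.η m : ℂ) • N.lambdaOf m A - Matrix.single m m (N.lambdaOf m A m m))

lemma residual_succ (β : Fin K → ℝ) (m : Fin M) :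
    N.residual β (m + 1) = N.residualStep m (N.residual β m) := by
  rw [residual, dif_pos m.isLt]; rfl

variable {N}

lemma one_lt_η (hC : ∀ m, 0 < N.C m) (m : Fin M) : 1 < N.η m :=
  Real.one_lt_rpow (by norm_num) (hC m)

lemma lambdaOf_diag (m : Fin M) (A : Matrix (Fin M) (Fin M) ℂ) :
    N.lambdaOf m A m m = 1 / ((N.η m : ℂ) - 1) * A m m := by
  simp [lambdaOf]

lemma lambdaOf_col {m i : Fin M} (hi : m < i) (A : Matrix (Fin M) (Fin M) ℂ) :
    N.lambdaOf m A i m = 1 / (N.η m : ℂ) * A i m := by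
  simp [lambdaOf, hi.not_gt, hi.ne']

/-- The residual step is a convex combination of truncation and Schur complement: on the
coordinates `> m` it subtracts `(1 - 1/η_m) A_{·m} A_{m·} / A_{mm}`. -/
lemma residualStep_eq {m : Fin M} (hη : 1 < N.η m) {A : Matrix (Fin M) (Fin M) ℂ}
    (hA : IsTailPosDef m A) :
    N.residualStep m A = (tailProj m)ᴴ * (A - (((1 - 1 / N.η m) / (A m m).re : ℝ) : ℂ) •
      vecMulVec (fun i => A i m) (star fun i => A i m)) * tailProj m := by
  have hg := hA.ofReal_re_diag m
  have hg0 : A m m ≠ 0 := by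
    rw [← hg]; exact_mod_cast hA.diag_pos.ne'
  have h0 : (N.η m : ℂ) ≠ 0 := by exact_mod_cast (by linarith : N.η m ≠ 0)
  have h1 : (N.η m : ℂ) - 1 ≠ 0 := by exact_mod_cast (by linarith : N.η m - 1 ≠ 0)
  have hs : ∀ i j, star (A j i) = A i j := fun i j => hA.isHermitian.apply i j
  rw [tailProj_conjTranspose]
  ext i j
  rw [tailProj, mul_diagonal, diagonal_mul]
  simp only [residualStep, Matrix.sub_apply, Matrix.smul_apply, vecMulVec_apply, smul_eq_mul,
    Pi.star_apply, hs, lambdaOf_diag, Complex.ofReal_div, Complex.ofReal_sub, Complex.ofReal_one, hg]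
  rcases lt_trichotomy i m with hi | rfl | hi
  · rw [hA.apply_eq_zero i j (Or.inl hi)]
    simp [lambdaOf, hi, hi.not_gt, hi.ne']
  · rcases lt_trichotomy j i with hj | rfl | hj
    · rw [hA.apply_eq_zero i j (Or.inr hj)]
      simp [lambdaOf, hj, hj.ne']
    · simp [lambdaOf]
      field_simp
      ring
    · simp [lambdaOf, hj.not_gt, hj.ne', hj.ne]
      field_simp
      ring
  · rcases lt_trichotomy j m with hj | rfl | hj
    · rw [hA.apply_eq_zero i j (Or.inr hj)]
      simp [lambdaOf, hj, hj.ne', hj.not_gt]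
    · simp [lambdaOf, hi.not_gt, hi.ne', hi.ne]
      field_simp
      ring
    · simp [lambdaOf, hi.not_gt, hj.not_gt, hi.ne', hj.ne', hi, hj, hi.ne]
      field_simp

/-- The form of the next residual matrix as a minimum over the coordinate `s` that is eliminated. -/
lemma hform_residualStep {m : Fin M} (hη : 1 < N.η m) {A : Matrix (Fin M) (Fin M) ℂ}
    (hA : IsTailPosDef m A) (x : Fin M → ℂ) (s : ℂ) :
    hform (N.residualStep m A) x + (1 - 1 / N.η m) / (A m m).re *
        ‖(A *ᵥ (tailProj m *ᵥ x)) m + s * (A m m).re‖ ^ 2 =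
      1 / N.η m * hform A (tailProj m *ᵥ x) + (1 - 1 / N.η m) *
        hform A (tailProj m *ᵥ x + s • Pi.single m 1) := by
  set y := tailProj m *ᵥ x
  have hg := hA.diag_pos
  have hc : star (fun i => A i m) ⬝ᵥ y = (A *ᵥ y) m := by
    simp only [dotProduct, mulVec, Pi.star_apply, hA.isHermitian.apply]
  have h1 : (star (s • (Pi.single m 1 : Fin M → ℂ)) ⬝ᵥ A *ᵥ y).re =
      (star s * (A *ᵥ y) m).re := by
    rw [star_smul, smul_dotProduct, Pi.star_single]; simp
  rw [residualStep_eq hη hA, hform_conj, hform_sub, hform_smul, hform_vecMulVec, hc,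
    hA.isHermitian.hform_add_vec, h1, hform_smul_vec, hform_single_vec]
  set c := (A *ᵥ y) m
  set g := (A m m).re
  have h2 : ‖c + s * g‖ ^ 2 = ‖c‖ ^ 2 + 2 * g * (star s * c).re + g ^ 2 * ‖s‖ ^ 2 := by
    simp only [← Complex.normSq_eq_norm_sq, Complex.normSq_apply]
    simp
    ring
  rw [h2]
  field_simp
  ring

lemma hform_residualStep_le {m : Fin M} (hη : 1 < N.η m) {A : Matrix (Fin M) (Fin M) ℂ}
    (hA : IsTailPosDef m A) (x : Fin M → ℂ) (s : ℂ) :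
    hform (N.residualStep m A) x ≤
      1 / N.η m * hform A (tailProj m *ᵥ x) + (1 - 1 / N.η m) *
        hform A (tailProj m *ᵥ x + s • Pi.single m 1) := by
  rw [← hform_residualStep hη hA]
  have : 1 / N.η m < 1 := (div_lt_one (by linarith)).2 hη
  have := div_nonneg (sub_nonneg.2 this.le) hA.diag_pos.le
  exact le_add_of_nonneg_right (by positivity)

lemma exists_hform_residualStep_eq {m : Fin M} (hη : 1 < N.η m) {A : Matrix (Fin M) (Fin M) ℂ}
    (hA : IsTailPosDef m A) (x : Fin M → ℂ) :
    ∃ s : ℂ, hform (N.residualStep m A) x =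
      1 / N.η m * hform A (tailProj m *ᵥ x) + (1 - 1 / N.η m) *
        hform A (tailProj m *ᵥ x + s • Pi.single m 1) := by
  have hg : ((A m m).re : ℂ) ≠ 0 := by exact_mod_cast hA.diag_pos.ne'
  refine ⟨-((A *ᵥ (tailProj m *ᵥ x)) m / (A m m).re), ?_⟩
  rw [← hform_residualStep hη hA, neg_mul, div_mul_cancel₀ _ hg]
  simp

lemma isTailPosDef_residualStep {m : Fin M} (hη : 1 < N.η m) {A : Matrix (Fin M) (Fin M) ℂ}
    (hA : IsTailPosDef m A) : IsTailPosDef (m + 1) (N.residualStep m A) where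
  isHermitian := by
    rw [residualStep_eq hη hA]
    refine isHermitian_conjTranspose_mul_mul _ (hA.isHermitian.sub ?_)
    rw [IsHermitian, conjTranspose_smul, conjTranspose_vecMulVec, star_star]
    congr 1
    exact Complex.conj_ofReal _
  apply_eq_zero i j hij := by
    rw [residualStep_eq hη hA, tailProj_conjTranspose, tailProj, mul_diagonal, diagonal_mul]
    rcases hij with h | h
    · have : ¬ m < i := by rw [Fin.lt_def]; omega
      simp [this]
    · have : ¬ m < j := by rw [Fin.lt_def]; omega
      simp [this]
  hform_pos x hx hx0 := by
    have hy : tailProj m *ᵥ x = x := by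
      ext i
      rw [tailProj_mulVec_apply]
      split_ifs with h
      · rfl
      · exact (hx i (by rw [Fin.lt_def] at h; omega)).symm
    obtain ⟨s, hs⟩ := exists_hform_residualStep_eq hη hA x
    rw [hs, hy]
    have h1 : 1 / N.η m < 1 := (div_lt_one (by linarith)).2 hη
    have h2 : 0 < 1 / N.η m := by positivity
    have h3 : 0 < hform A x := hA.hform_pos x (fun i hi => hx i (by omega)) hx0
    have h4 : 0 ≤ hform A (x + s • Pi.single m 1) := by
      rcases eq_or_ne (x + s • Pi.single m 1) 0 with h | h
      · rw [h]; simp [hform]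
      · refine (hA.hform_pos _ (fun i hi => ?_) h).le
        have : i ≠ m := fun h => by rw [h] at hi; exact lt_irrefl _ hi
        simp [hx i (by omega), this]
    have := mul_nonneg (sub_nonneg.2 h1.le) h4
    positivity

lemma hform_hh (k : Fin K) (x : Fin M → ℂ) : hform (N.hh k) x = ‖star (N.h k) ⬝ᵥ x‖ ^ 2 :=
  hform_vecMulVec _ _

lemma hh_isHermitian (k : Fin K) : (N.hh k).IsHermitian := by
  rw [hh, IsHermitian, conjTranspose_vecMulVec, star_star]

lemma ofReal_smul_isHermitian {A : Matrix (Fin M) (Fin M) ℂ} (hA : A.IsHermitian) (r : ℝ) :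
    ((r : ℂ) • A).IsHermitian := by
  rw [IsHermitian, conjTranspose_smul, hA.eq]
  congr 1
  exact Complex.conj_ofReal _

lemma hform_Γ (β : Fin K → ℝ) (x : Fin M → ℂ) :
    hform (N.Γ β) x = ∑ i, ‖x i‖ ^ 2 + ∑ k, β k * ‖star (N.h k) ⬝ᵥ x‖ ^ 2 := by
  simp only [Γ, hform_add, hform_one, hform_sum, hform_smul, hform_hh]

lemma sum_norm_sq_pos {x : Fin M → ℂ} (hx : x ≠ 0) : 0 < ∑ i, ‖x i‖ ^ 2 := by
  obtain ⟨i, hi⟩ := Function.ne_iff.1 hx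
  exact Finset.sum_pos' (fun _ _ => by positivity) ⟨i, Finset.mem_univ i, by
    have : 0 < ‖x i‖ := norm_pos_iff.2 hi
    positivity⟩

lemma isHermitian_sum {ι : Type*} (s : Finset ι) {A : ι → Matrix (Fin M) (Fin M) ℂ}
    (hA : ∀ i ∈ s, (A i).IsHermitian) : (∑ i ∈ s, A i).IsHermitian := by
  rw [IsHermitian, conjTranspose_sum]
  exact Finset.sum_congr rfl fun i hi => (hA i hi).eq

lemma isTailPosDef_residual (hC : ∀ m, 0 < N.C m) {β : Fin K → ℝ} (hβ : 0 ≤ β) (n : ℕ)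
    (hn : n ≤ M) : IsTailPosDef n (N.residual β n) := by
  induction n with
  | zero =>
    refine ⟨isHermitian_one.add (isHermitian_sum _ fun k _ =>
      ofReal_smul_isHermitian (hh_isHermitian k) _), by simp, fun x _ hx => ?_⟩
    rw [residual, hform_Γ]
    exact add_pos_of_pos_of_nonneg (sum_norm_sq_pos hx)
      (Finset.sum_nonneg fun k _ => mul_nonneg (hβ k) (by positivity))
  | succ n ih =>
    rw [N.residual_succ β ⟨n, hn⟩]
    exact isTailPosDef_residualStep (m := ⟨n, hn⟩) (one_lt_η hC _) (ih (by omega))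

lemma residual_last (hC : ∀ m, 0 < N.C m) {β : Fin K → ℝ} (hβ : 0 ≤ β) : N.residual β M = 0 := by
  ext i j
  exact (isTailPosDef_residual hC hβ M le_rfl).apply_eq_zero i j (Or.inl i.isLt)

/-- The residual matrices are monotone and subhomogeneous in the Loewner order. -/
lemma hform_residual_le (hC : ∀ m, 0 < N.C m) {β β' : Fin K → ℝ} (hβ : 0 ≤ β) (hβ' : 0 ≤ β')
    {t : ℝ} (ht : 1 ≤ t) (h : β ≤ t • β') (n : ℕ) (hn : n ≤ M) (x : Fin M → ℂ) :
    hform (N.residual β n) x ≤ t * hform (N.residual β' n) x := by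
  induction n generalizing x with
  | zero =>
    rw [residual, residual, hform_Γ, hform_Γ, mul_add, Finset.mul_sum (Finset.univ : Finset (Fin K))]
    refine add_le_add (le_mul_of_one_le_left (by positivity) ht) ?_
    refine Finset.sum_le_sum fun k _ => ?_
    rw [← mul_assoc]
    exact mul_le_mul_of_nonneg_right (h k) (by positivity)
  | succ n ih =>
    have hη := one_lt_η hC ⟨n, hn⟩
    rw [N.residual_succ β ⟨n, hn⟩, N.residual_succ β' ⟨n, hn⟩]
    obtain ⟨s, hs⟩ := exists_hform_residualStep_eq hη (isTailPosDef_residual hC hβ' n (by omega)) x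
    refine (hform_residualStep_le hη (isTailPosDef_residual hC hβ n (by omega)) x s).trans ?_
    rw [hs, mul_add, mul_left_comm, mul_left_comm t (1 - _)]
    have h1 : 1 / N.η ⟨n, hn⟩ < 1 := (div_lt_one (by linarith)).2 hη
    have h2 : 0 < 1 / N.η ⟨n, hn⟩ := by positivity
    exact add_le_add (mul_le_mul_of_nonneg_left (ih (by omega) _) h2.le)
      (mul_le_mul_of_nonneg_left (ih (by omega) _) (sub_nonneg.2 h1.le))

end Network

/-! ### The dual mapping -/

namespace Network

variable {M K : ℕ} {N : Network M K}

lemma Λ_diag_re (hC : ∀ m, 0 < N.C m) {β : Fin K → ℝ} (hβ : 0 ≤ β) (m : Fin M) :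
    N.Λ β m m m = (((N.residual β m m m).re / (N.η m - 1) : ℝ) : ℂ) := by
  rw [Λ, lambdaOf_diag, ← (isTailPosDef_residual hC hβ m m.isLt.le).ofReal_re_diag m]
  push_cast
  rw [Complex.ofReal_re]
  ring

lemma ofReal_re_Λ_diag (hC : ∀ m, 0 < N.C m) {β : Fin K → ℝ} (hβ : 0 ≤ β) (m : Fin M) :
    ((N.Λ β m m m).re : ℂ) = N.Λ β m m m := by
  rw [Λ_diag_re hC hβ, Complex.ofReal_re]

lemma Λ_diag_pos (hC : ∀ m, 0 < N.C m) {β : Fin K → ℝ} (hβ : 0 ≤ β) (m : Fin M) :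
    0 < (N.Λ β m m m).re := by
  rw [Λ_diag_re hC hβ, Complex.ofReal_re]
  exact div_pos (isTailPosDef_residual hC hβ m m.isLt.le).diag_pos
    (sub_pos.2 (one_lt_η hC m))

lemma Λ_diag_le (hC : ∀ m, 0 < N.C m) {β β' : Fin K → ℝ} (hβ : 0 ≤ β) (hβ' : 0 ≤ β')
    {t : ℝ} (ht : 1 ≤ t) (h : β ≤ t • β') (m : Fin M) :
    (N.Λ β m m m).re ≤ t * (N.Λ β' m m m).re := by
  rw [Λ_diag_re hC hβ, Λ_diag_re hC hβ', Complex.ofReal_re, Complex.ofReal_re, ← mul_div_assoc]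
  have := hform_residual_le hC hβ hβ' ht h m m.isLt.le (Pi.single m 1)
  rw [hform_single_vec, hform_single_vec] at this
  exact div_le_div_of_nonneg_right this (sub_pos.2 (one_lt_η hC m)).le

lemma hform_Cmat (β : Fin K → ℝ) (k : Fin K) (x : Fin M → ℂ) :
    hform (N.Cmat β k) x = ∑ i, ‖x i‖ ^ 2
      + ∑ j ∈ Finset.univ.erase k, β j * ‖star (N.h j) ⬝ᵥ x‖ ^ 2
      + ∑ m, (N.Λ β m m m).re * ‖x m‖ ^ 2 := by
  simp only [Cmat, hform_add, hform_one, hform_sum, hform_smul, hform_hh, hform_single]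

lemma Cmat_posDef (hC : ∀ m, 0 < N.C m) {β : Fin K → ℝ} (hβ : 0 ≤ β) (k : Fin K) :
    (N.Cmat β k).PosDef := by
  refine IsHermitian.posDef_of_hform ((isHermitian_one.add (isHermitian_sum _ fun k _ =>
    ofReal_smul_isHermitian (hh_isHermitian k) _)).add (isHermitian_sum _ fun m _ => ?_))
    fun x hx => ?_
  · rw [IsHermitian, conjTranspose_single, ← ofReal_re_Λ_diag hC hβ]
    congr 1
    exact Complex.conj_ofReal _
  · rw [hform_Cmat]
    have h1 := sum_norm_sq_pos hx
    have h2 : 0 ≤ ∑ j ∈ Finset.univ.erase k, β j * ‖star (N.h j) ⬝ᵥ x‖ ^ 2 :=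
      Finset.sum_nonneg fun j _ => mul_nonneg (hβ j) (by positivity)
    have h3 : 0 ≤ ∑ m, (N.Λ β m m m).re * ‖x m‖ ^ 2 :=
      Finset.sum_nonneg fun m _ => mul_nonneg (Λ_diag_pos hC hβ m).le (by positivity)
    linarith

/-- The matrices `C_k(β) - I` are monotone and subhomogeneous in `β`. -/
lemma hform_Cmat_le (hC : ∀ m, 0 < N.C m) {β β' : Fin K → ℝ} (hβ : 0 ≤ β) (hβ' : 0 ≤ β')
    {t : ℝ} (ht : 1 ≤ t) (h : β ≤ t • β') (k : Fin K) (x : Fin M → ℂ) :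
    hform (N.Cmat β k) x ≤ t * hform (N.Cmat β' k) x - (t - 1) * ∑ i, ‖x i‖ ^ 2 := by
  rw [hform_Cmat, hform_Cmat, mul_add, mul_add, Finset.mul_sum (Finset.univ.erase k),
    Finset.mul_sum _ (fun m => (N.Λ β' m m m).re * ‖x m‖ ^ 2)]
  have h2 : ∑ j ∈ Finset.univ.erase k, β j * ‖star (N.h j) ⬝ᵥ x‖ ^ 2 ≤
      ∑ j ∈ Finset.univ.erase k, t * (β' j * ‖star (N.h j) ⬝ᵥ x‖ ^ 2) := by
    refine Finset.sum_le_sum fun j _ => ?_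
    rw [← mul_assoc]
    exact mul_le_mul_of_nonneg_right (h j) (by positivity)
  have h3 : ∑ m, (N.Λ β m m m).re * ‖x m‖ ^ 2 ≤ ∑ m, t * ((N.Λ β' m m m).re * ‖x m‖ ^ 2) := by
    refine Finset.sum_le_sum fun m _ => ?_
    rw [← mul_assoc]
    exact mul_le_mul_of_nonneg_right (Λ_diag_le hC hβ hβ' ht h m) (by positivity)
  linarith

lemma lam_nonneg (β : Fin K → ℝ) : 0 ≤ N.lam β := Real.iSup_nonneg fun _ => norm_nonneg _

/-- `C_k(β) ≼ (1 + λ(β)) I`. -/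
lemma hform_Cmat_le_lam (β : Fin K → ℝ) (k : Fin K) (x : Fin M → ℂ) :
    hform (N.Cmat β k) x ≤ (1 + N.lam β) * ∑ i, ‖x i‖ ^ 2 := by
  set T := Matrix.toEuclideanCLM (n := Fin M) (𝕜 := ℂ) (N.Cmat β k - 1) with hT
  have hle : ‖T‖ ≤ N.lam β :=
    le_ciSup (f := fun k => ‖Matrix.toEuclideanCLM (n := Fin M) (𝕜 := ℂ) (N.Cmat β k - 1)‖)
      (Set.finite_range _).bddAbove k
  set y : EuclideanSpace ℂ (Fin M) := WithLp.toLp 2 x with hy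
  have hnorm : ‖y‖ ^ 2 = ∑ i, ‖x i‖ ^ 2 := EuclideanSpace.norm_sq_eq y
  have hin : hform (N.Cmat β k - 1) x = (inner ℂ y (T y)).re := by
    rw [hform, EuclideanSpace.inner_eq_star_dotProduct, dotProduct_comm]
    rfl
  have h1 : (inner ℂ y (T y)).re ≤ ‖T‖ * ‖y‖ ^ 2 :=
    calc (inner ℂ y (T y)).re ≤ ‖inner ℂ y (T y)‖ := Complex.re_le_norm _
      _ ≤ ‖y‖ * ‖T y‖ := norm_inner_le_norm _ _
      _ ≤ ‖y‖ * (‖T‖ * ‖y‖) := by gcongr; exact T.le_opNorm y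
      _ = ‖T‖ * ‖y‖ ^ 2 := by ring
  have h2 : ‖T‖ * ‖y‖ ^ 2 ≤ N.lam β * ‖y‖ ^ 2 := by gcongr
  rw [hform_sub, hform_one] at hin
  rw [hnorm] at h1 h2
  linarith

lemma hform_inv_Cmat_pos (hC : ∀ m, 0 < N.C m) (hh : ∀ k, N.h k ≠ 0) {β : Fin K → ℝ} (hβ : 0 ≤ β)
    (k : Fin K) : 0 < hform (N.Cmat β k)⁻¹ (N.h k) :=
  (Cmat_posDef hC hβ k).inv.hform_pos (hh k)

lemma dualMap_pos (hγ : ∀ k, 0 < N.γ k) (hC : ∀ m, 0 < N.C m) (hh : ∀ k, N.h k ≠ 0)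
    {β : Fin K → ℝ} (hβ : 0 ≤ β) (k : Fin K) : 0 < N.dualMap β k :=
  div_pos (hγ k) (hform_inv_Cmat_pos hC hh hβ k)

/-- A quantitative form of subhomogeneity: if `C_k(β') ≼ (1 + c) I`, then scaling `β'` by `t`
scales the dual mapping by at most `(1 + t c) / (1 + c)`. -/
lemma dualMap_le (hγ : ∀ k, 0 < N.γ k) (hC : ∀ m, 0 < N.C m) (hh : ∀ k, N.h k ≠ 0)
    {β β' : Fin K → ℝ} (hβ : 0 ≤ β) (hβ' : 0 ≤ β') {t : ℝ} (ht : 1 ≤ t) (h : β ≤ t • β') {c : ℝ}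
    (hc : 0 ≤ c) (hle : ∀ k x, hform (N.Cmat β' k) x ≤ (1 + c) * ∑ i, ‖x i‖ ^ 2) (k : Fin K) :
    N.dualMap β k ≤ (1 + t * c) / (1 + c) * N.dualMap β' k := by
  have hcmp : ∀ x, hform (N.Cmat β k) x ≤ (1 + t * c) / (1 + c) * hform (N.Cmat β' k) x := by
    intro x
    have h1 := hform_Cmat_le hC hβ hβ' ht h k x
    have h2 := hle k x
    have h3 : (1 + t * c) / (1 + c) = t - (t - 1) / (1 + c) := by field_simp; ring
    have h4 : (t - 1) / (1 + c) * hform (N.Cmat β' k) x ≤ (t - 1) * ∑ i, ‖x i‖ ^ 2 := by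
      rw [div_mul_eq_mul_div, div_le_iff₀ (by linarith), mul_assoc, mul_comm (∑ i, _)]
      exact mul_le_mul_of_nonneg_left h2 (by linarith)
    rw [h3, sub_mul]
    linarith
  have hinv := (Cmat_posDef hC hβ k).hform_inv_le (Cmat_posDef hC hβ' k) hcmp (N.h k)
  have p1 := hform_inv_Cmat_pos hC hh hβ k
  have p2 := hform_inv_Cmat_pos hC hh hβ' k
  rw [dualMap, dualMap, ← mul_div_assoc, div_le_div_iff₀ p1 p2]
  have := mul_le_mul_of_nonneg_left hinv (hγ k).le
  linarith

lemma dualMap_le_lam (hγ : ∀ k, 0 < N.γ k) (hC : ∀ m, 0 < N.C m) (hh : ∀ k, N.h k ≠ 0)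
    {β β' : Fin K → ℝ} (hβ : 0 ≤ β) (hβ' : 0 ≤ β') {t : ℝ} (ht : 1 ≤ t) (h : β ≤ t • β')
    (k : Fin K) :
    N.dualMap β k ≤ (1 + t * N.lam β') / (1 + N.lam β') * N.dualMap β' k :=
  dualMap_le hγ hC hh hβ hβ' ht h (lam_nonneg β') (hform_Cmat_le_lam β') k

lemma dualMap_mono (hγ : ∀ k, 0 < N.γ k) (hC : ∀ m, 0 < N.C m) (hh : ∀ k, N.h k ≠ 0)
    {β β' : Fin K → ℝ} (hβ : 0 ≤ β) (h : β ≤ β') : N.dualMap β ≤ N.dualMap β' := fun k => by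
  have := dualMap_le_lam hγ hC hh hβ (hβ.trans h) le_rfl (by simpa using h) k
  have hl := lam_nonneg (N := N) β'
  rwa [one_mul, div_self (by linarith), one_mul] at this

lemma isStandardInterference_dualMap (hγ : ∀ k, 0 < N.γ k) (hC : ∀ m, 0 < N.C m)
    (hh : ∀ k, N.h k ≠ 0) : IsStandardInterference N.dualMap where
  nonneg β hβ k := (dualMap_pos hγ hC hh hβ k).le
  strictSubhomogeneous t ht β hβ _ k := by
    refine (dualMap_le_lam hγ hC hh (smul_nonneg (by linarith) hβ) hβ ht.le le_rfl k).trans_lt ?_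
    refine mul_lt_mul_of_pos_right ?_ (dualMap_pos hγ hC hh hβ k)
    have hl := lam_nonneg (N := N) β
    rw [div_lt_iff₀ (by linarith)]
    linarith
  monotone _ _ hβ h := dualMap_mono hγ hC hh hβ h

/-- The counterpart of `dualMap_le_lam` with the constant `λ(β')` of the dominated point `β'`,
which holds because `C_k(β'/t) ≼ C_k(β') ≼ (1 + λ(β')) I`. The two together compare `I(β)` and
`I(β')` in both directions with the same constant. -/
lemma dualMap_le_lam_of_le_smul (hγ : ∀ k, 0 < N.γ k) (hC : ∀ m, 0 < N.C m) (hh : ∀ k, N.h k ≠ 0)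
    {β β' : Fin K → ℝ} (hβ' : 0 ≤ β') {t : ℝ} (ht : 1 ≤ t) (h : β' ≤ t • β)
    (k : Fin K) :
    N.dualMap β' k ≤ (1 + t * N.lam β') / (1 + N.lam β') * N.dualMap β k := by
  have ht0 : 0 < t := by linarith
  have hl := lam_nonneg (N := N) β'
  have h0 : 0 ≤ t⁻¹ • β' := smul_nonneg (by positivity) hβ'
  have h1 : t⁻¹ • β' ≤ β := fun k => by
    have := h k
    simp only [Pi.smul_apply, smul_eq_mul] at this ⊢
    rwa [inv_mul_le_iff₀ ht0]
  have h2 : t⁻¹ • β' ≤ (1 : ℝ) • β' := fun k => by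
    simp only [Pi.smul_apply, smul_eq_mul]
    exact mul_le_mul_of_nonneg_right (inv_le_one_of_one_le₀ ht) (hβ' k)
  have h3 : N.dualMap β' k ≤ (1 + t * N.lam β') / (1 + N.lam β') * N.dualMap (t⁻¹ • β') k := by
    refine dualMap_le hγ hC hh hβ' h0 ht (by rw [smul_inv_smul₀ ht0.ne']) hl (fun k x => ?_) k
    have h4 := hform_Cmat_le hC h0 hβ' le_rfl h2 k x
    have h5 := hform_Cmat_le_lam (N := N) β' k x
    linarith
  refine h3.trans (mul_le_mul_of_nonneg_left (dualMap_mono hγ hC hh h0 h1 k) ?_)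
  positivity

end Network

/-! ### Thompson's metric and interference mappings -/

section Thompson

variable {K : ℕ} {x y : Fin K → ℝ}

lemma thompson_nonneg (x y : Fin K → ℝ) : 0 ≤ thompson x y :=
  Real.iSup_nonneg fun _ => abs_nonneg _

lemma abs_log_div_le_iff {a b c : ℝ} (ha : 0 < a) (hb : 0 < b) :
    |Real.log (a / b)| ≤ c ↔ a ≤ Real.exp c * b ∧ b ≤ Real.exp c * a := by
  rw [abs_le, Real.log_div ha.ne' hb.ne', ← Real.log_le_log_iff ha (by positivity),
    ← Real.log_le_log_iff hb (by positivity), Real.log_mul (Real.exp_pos c).ne' hb.ne',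
    Real.log_mul (Real.exp_pos c).ne' ha.ne', Real.log_exp]
  constructor
  · rintro ⟨h1, h2⟩; constructor <;> linarith
  · rintro ⟨h1, h2⟩; constructor <;> linarith

lemma abs_log_le_thompson (x y : Fin K → ℝ) (k : Fin K) :
    |Real.log (x k / y k)| ≤ thompson x y :=
  le_ciSup (f := fun k => |Real.log (x k / y k)|) (Set.finite_range _).bddAbove k

lemma le_exp_thompson_left (hx : ∀ k, 0 < x k) (hy : ∀ k, 0 < y k) :
    x ≤ Real.exp (thompson x y) • y := fun k =>
  ((abs_log_div_le_iff (hx k) (hy k)).1 (abs_log_le_thompson x y k)).1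

lemma le_exp_thompson_right (hx : ∀ k, 0 < x k) (hy : ∀ k, 0 < y k) :
    y ≤ Real.exp (thompson x y) • x := fun k =>
  ((abs_log_div_le_iff (hx k) (hy k)).1 (abs_log_le_thompson x y k)).2

lemma thompson_le_log (hx : ∀ k, 0 < x k) (hy : ∀ k, 0 < y k) {r : ℝ} (hr : 1 ≤ r)
    (hxy : ∀ k, x k ≤ r * y k) (hyx : ∀ k, y k ≤ r * x k) : thompson x y ≤ Real.log r := by
  refine Real.iSup_le (fun k => (abs_log_div_le_iff (hx k) (hy k)).2 ?_) (Real.log_nonneg hr)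
  rw [Real.exp_log (by linarith)]
  exact ⟨hxy k, hyx k⟩

lemma IsStandardInterference.thompson_lt {f : (Fin K → ℝ) → Fin K → ℝ}
    (hf : IsStandardInterference f) (hpos : ∀ x, 0 ≤ x → ∀ k, 0 < f x k)
    (hx : ∀ k, 0 < x k) (hy : ∀ k, 0 < y k) (hxy : x ≠ y) :
    thompson (f x) (f y) < thompson x y := by
  have hx0 : 0 ≤ x := fun k => (hx k).le
  have hy0 : 0 ≤ y := fun k => (hy k).le
  obtain ⟨k₀, hk₀⟩ := Function.ne_iff.1 hxy
  have : Nonempty (Fin K) := ⟨k₀⟩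
  have hl := le_exp_thompson_left hx hy
  have hr := le_exp_thompson_right hx hy
  set c := thompson x y with hc
  have hc0 : 0 < c := by
    refine (thompson_nonneg x y).lt_of_ne fun h => hk₀ ?_
    rw [hc, ← h, Real.exp_zero, one_smul] at hl hr
    exact le_antisymm (hl k₀) (hr k₀)
  have he : 1 < Real.exp c := Real.one_lt_exp_iff.2 hc0
  have key : ∀ u v : Fin K → ℝ, 0 ≤ u → 0 ≤ v → v k₀ ≠ 0 → u ≤ Real.exp c • v → ∀ k,
      f u k < Real.exp c * f v k := fun u v hu hv hv0 huv k =>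
    (hf.monotone _ _ hu huv k).trans_lt (hf.strictSubhomogeneous _ he v hv
      (fun h => hv0 (by rw [h]; rfl)) k)
  obtain ⟨k, hk⟩ := exists_eq_ciSup_of_finite (f := fun k => |Real.log (f x k / f y k)|)
  rw [thompson, ← hk]
  have h1 := key x y hx0 hy0 (hy k₀).ne' hl k
  have h2 := key y x hy0 hx0 (hx k₀).ne' hr k
  have p1 := hpos x hx0 k
  have p2 := hpos y hy0 k
  rw [← Real.log_lt_log_iff p1 (by positivity), Real.log_mul (Real.exp_pos c).ne' p2.ne',
    Real.log_exp] at h1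
  rw [← Real.log_lt_log_iff p2 (by positivity), Real.log_mul (Real.exp_pos c).ne' p1.ne',
    Real.log_exp] at h2
  rw [Real.log_div p1.ne' p2.ne', abs_lt]
  constructor <;> linarith

/-- The iterates that start at `0` increase. If points with `x ≤ f x` are bounded, they converge,
and monotonicity with subhomogeneity replaces continuity at the limit. -/
lemma IsStandardInterference.exists_fixedPoint {f : (Fin K → ℝ) → Fin K → ℝ}
    (hf : IsStandardInterference f) (hpos : ∀ x, 0 ≤ x → ∀ k, 0 < f x k) (b : Fin K → ℝ)
    (hb : ∀ x, 0 ≤ x → x ≤ f x → x ≤ b) : ∃ x, (∀ k, 0 < x k) ∧ f x = x := by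
  set u : ℕ → Fin K → ℝ := fun i => f^[i] 0 with hu
  have hsucc : ∀ i, u (i + 1) = f (u i) := fun i => Function.iterate_succ_apply' f i 0
  have hu0 : ∀ i, 0 ≤ u i := by
    intro i
    induction i with
    | zero => exact le_rfl
    | succ i ih => rw [hsucc]; exact hf.nonneg _ ih
  have hle : ∀ i, u i ≤ u (i + 1) := by
    intro i
    induction i with
    | zero => exact hu0 1
    | succ i ih => rw [hsucc i, hsucc (i + 1)]; exact hf.monotone _ _ (hu0 i) ih
  have hmono : Monotone u := monotone_nat_of_le_succ hle
  have hbdd : ∀ i, u i ≤ b := fun i => hb _ (hu0 i) (by rw [← hsucc]; exact hle i)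
  have hlim : ∀ k, Tendsto (fun i => u i k) atTop (𝓝 (⨆ i, u i k)) := fun k =>
    tendsto_atTop_ciSup (fun i j hij => hmono hij k) ⟨b k, by rintro _ ⟨i, rfl⟩; exact hbdd i k⟩
  set L : Fin K → ℝ := fun k => ⨆ i, u i k with hL
  have huL : ∀ i, u i ≤ L := fun i k =>
    le_ciSup (f := fun i => u i k) ⟨b k, by rintro _ ⟨i, rfl⟩; exact hbdd i k⟩ i
  have hL0 : 0 ≤ L := (hu0 0).trans (huL 0)
  have hLpos : ∀ k, 0 < L k := fun k =>
    (hpos 0 le_rfl k).trans_le ((hsucc 0).symm ▸ huL 1 k)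
  refine ⟨L, hLpos, le_antisymm (fun k => ?_) (fun k => ?_)⟩
  · refine le_of_forall_gt_imp_ge_of_dense fun z hz => ?_
    have hz1 : 1 < z / L k := (one_lt_div (hLpos k)).2 hz
    set a := z / L k with ha
    have hev : ∀ᶠ i in atTop, ∀ j, L j < a * u i j := by
      rw [eventually_all]
      intro j
      have := (hlim j).const_mul a
      exact this.eventually (lt_mem_nhds (by
        have := hLpos j
        change L j < a * L j
        nlinarith))
    obtain ⟨i, hi⟩ := hev.exists
    have h1 : f L k ≤ f (a • u i) k := hf.monotone _ _ hL0 (fun j => (hi j).le) k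
    have hui : u i ≠ 0 := fun h => by
      have := hi k
      rw [h] at this
      have h2 := hLpos k
      simp at this
      linarith
    have h2 := hf.strictSubhomogeneous a hz1 (u i) (hu0 i) hui k
    rw [← hsucc] at h2
    have h3 : a * u (i + 1) k ≤ a * L k := mul_le_mul_of_nonneg_left (huL _ k) (by linarith)
    have h4 : a * L k = z := div_mul_cancel₀ _ (hLpos k).ne'
    linarith
  · refine ciSup_le fun i => (hle i k).trans ?_
    rw [hsucc]
    exact hf.monotone _ _ (hu0 i) (huL i) k

/-- Logarithmic form of the subhomogeneity factor `(1 + t c) / (1 + c)`, from the weighted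
inequality between the arithmetic and the geometric mean. -/
lemma log_rate_le {c s : ℝ} (hc : 0 ≤ c) :
    Real.log ((1 + Real.exp s * c) / (1 + c)) ≤
      c * Real.exp s / (1 + c * Real.exp s) * s := by
  have he := Real.exp_pos s
  have h0 : 0 < 1 + c * Real.exp s := by positivity
  have h := Real.geom_mean_le_arith_mean2_weighted (w₁ := 1 / (1 + c * Real.exp s))
    (w₂ := c * Real.exp s / (1 + c * Real.exp s)) (p₁ := 1) (p₂ := Real.exp (-s))
    (by positivity) (by positivity) zero_le_one (Real.exp_pos _).le (by field_simp)
  rw [Real.one_rpow, one_mul, ← Real.exp_mul] at h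
  have h1 : 1 / (1 + c * Real.exp s) * 1 + c * Real.exp s / (1 + c * Real.exp s) * Real.exp (-s) =
      (1 + c) / (1 + c * Real.exp s) := by
    rw [Real.exp_neg]; field_simp
  rw [h1, ← Real.le_log_iff_exp_le (by positivity)] at h
  rw [mul_comm (Real.exp s) c, ← inv_div, Real.log_inv]
  linarith

/-- The contraction factor at distance `s` from the fixed point. -/
noncomputable def contractionFactor (c s : ℝ) : ℝ := c * Real.exp s / (1 + c * Real.exp s)

lemma contractionFactor_nonneg {c : ℝ} (hc : 0 ≤ c) (s : ℝ) : 0 ≤ contractionFactor c s := by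
  unfold contractionFactor; positivity

lemma contractionFactor_lt_one {c : ℝ} (hc : 0 ≤ c) (s : ℝ) : contractionFactor c s < 1 := by
  rw [contractionFactor, div_lt_one (by positivity)]; linarith

lemma contractionFactor_mono {c : ℝ} (hc : 0 ≤ c) {s s' : ℝ} (h : s ≤ s') :
    contractionFactor c s ≤ contractionFactor c s' := by
  rw [contractionFactor, contractionFactor, div_le_div_iff₀ (by positivity) (by positivity)]
  have : c * Real.exp s ≤ c * Real.exp s' :=
    mul_le_mul_of_nonneg_left (Real.exp_le_exp.2 h) hc
  linarith

lemma thompson_map_le {f : (Fin K → ℝ) → Fin K → ℝ} {c : ℝ} (hc : 0 ≤ c)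
    (hx : ∀ k, 0 < x k) (hfx : ∀ k, 0 < f x k) (hy : ∀ k, 0 < y k)
    (hl : ∀ t : ℝ, 1 ≤ t → x ≤ t • y → ∀ k, f x k ≤ (1 + t * c) / (1 + c) * y k)
    (hr : ∀ t : ℝ, 1 ≤ t → y ≤ t • x → ∀ k, y k ≤ (1 + t * c) / (1 + c) * f x k) :
    thompson (f x) y ≤ contractionFactor c (thompson x y) * thompson x y := by
  have he : 1 ≤ Real.exp (thompson x y) := Real.one_le_exp (thompson_nonneg x y)
  refine (thompson_le_log hfx hy ?_ (hl _ he (le_exp_thompson_left hx hy))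
    (hr _ he (le_exp_thompson_right hx hy))).trans (log_rate_le hc)
  rw [one_le_div (by linarith)]
  nlinarith

lemma norm_sub_le_thompson (hx : ∀ k, 0 < x k) (hy : ∀ k, 0 < y k) :
    ‖x - y‖ ≤ ‖y‖ * Real.exp (thompson x y) * thompson x y := by
  have h0 := thompson_nonneg x y
  have hl := le_exp_thompson_left hx hy
  have hr := le_exp_thompson_right hx hy
  set s := thompson x y
  refine (pi_norm_le_iff_of_nonneg (by positivity)).2 fun k => ?_
  have h1 : x k ≤ Real.exp s * y k := hl k
  have h2 : y k ≤ Real.exp s * x k := hr k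
  have hk : y k ≤ ‖y‖ := (le_abs_self _).trans (norm_le_pi_norm y k)
  have he : 1 ≤ Real.exp s := Real.one_le_exp h0
  have he2 : Real.exp s - 1 ≤ Real.exp s * s := by
    have := Real.add_one_le_exp (-s)
    rw [Real.exp_neg] at this
    have h3 : Real.exp s * (Real.exp s)⁻¹ = 1 := mul_inv_cancel₀ (Real.exp_pos s).ne'
    nlinarith
  have h4 : |x k - y k| ≤ (Real.exp s - 1) * y k := by
    have hy' := hy k
    rw [abs_le]
    constructor
    · by_cases h5 : y k ≤ x k <;> nlinarith
    · linarith
  rw [Pi.sub_apply, Real.norm_eq_abs]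
  calc |x k - y k| ≤ (Real.exp s - 1) * y k := h4
    _ ≤ (Real.exp s * s) * ‖y‖ := mul_le_mul he2 hk (hy k).le (by positivity)
    _ = ‖y‖ * Real.exp s * s := by ring

lemma ConvergesLinearly.tendsto {u : ℕ → Fin K → ℝ} {a : Fin K → ℝ} (h : ConvergesLinearly u a) :
    Tendsto u atTop (𝓝 a) := by
  obtain ⟨A, r, hr0, hr1, h⟩ := h
  rw [tendsto_iff_norm_sub_tendsto_zero]
  refine squeeze_zero (fun _ => norm_nonneg _) h ?_
  simpa using (tendsto_pow_atTop_nhds_zero_of_lt_one hr0 hr1).const_mul A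

/-- Convergence of a sequence of positive vectors whose Thompson distances to `a` satisfy
`μ_{i+1} ≤ θ(μ_i) μ_i` with the contraction factor `θ`. -/
lemma convergence_of_thompson_le {u : ℕ → Fin K → ℝ} {a : Fin K → ℝ} {c : ℝ} (hc : 0 ≤ c)
    (ha : ∀ k, 0 < a k) (hu : ∀ i, 1 ≤ i → ∀ k, 0 < u i k)
    (h : ∀ i, 1 ≤ i → thompson (u (i + 1)) a ≤
      contractionFactor c (thompson (u i) a) * thompson (u i) a) :
    ConvergesLinearly u a ∧
    (∃ c : ℝ, 0 ≤ c ∧ c < 1 ∧ ∀ i : ℕ, 1 ≤ i → thompson (u (i + 1)) a ≤ c * thompson (u i) a) ∧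
    limsup (fun i : ℕ => ((thompson (u (i + 1)) a / thompson (u i) a : ℝ) : EReal)) atTop
      ≤ ((c / (1 + c) : ℝ) : EReal) := by
  set μ : ℕ → ℝ := fun i => thompson (u i) a with hμ
  have hμ0 : ∀ i, 0 ≤ μ i := fun i => thompson_nonneg _ _
  have hdec : ∀ i, μ (i + 1) ≤ μ 1 := by
    intro i
    induction i with
    | zero => exact le_rfl
    | succ i ih =>
      refine ((h (i + 1) (by omega)).trans ?_).trans ih
      exact mul_le_of_le_one_left (hμ0 _) (contractionFactor_lt_one hc _).le
  set θ := contractionFactor c (μ 1) with hθ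
  have hstep : ∀ i, 1 ≤ i → μ (i + 1) ≤ θ * μ i := by
    intro i hi
    obtain ⟨j, rfl⟩ := Nat.exists_eq_add_of_le' hi
    exact (h _ hi).trans (mul_le_mul_of_nonneg_right (contractionFactor_mono hc (hdec j)) (hμ0 _))
  have hlin : ConvergesLinearly u a := by
    -- the rate is kept positive so that the term `i = 0` can be absorbed into the constant
    set r := max θ (1 / 2) with hr
    have hr0 : 0 < r := lt_max_of_lt_right (by norm_num)
    have hr1 : r < 1 := max_lt (contractionFactor_lt_one hc _) (by norm_num)
    have hgeo : ∀ i, μ (i + 1) ≤ r ^ i * μ 1 := by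
      intro i
      induction i with
      | zero => simp
      | succ i ih =>
        calc μ (i + 1 + 1) ≤ θ * μ (i + 1) := hstep _ (by omega)
          _ ≤ r * (r ^ i * μ 1) := mul_le_mul (le_max_left _ _) ih (hμ0 _) hr0.le
          _ = r ^ (i + 1) * μ 1 := by ring
    refine ⟨‖u 0 - a‖ + ‖a‖ * Real.exp (μ 1) * μ 1 / r, r, hr0.le, hr1, fun i => ?_⟩
    have hnn : 0 ≤ ‖a‖ * Real.exp (μ 1) * μ 1 / r :=
      div_nonneg (mul_nonneg (by positivity) (hμ0 1)) hr0.le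
    cases i with
    | zero => simpa using hnn
    | succ i =>
      calc ‖u (i + 1) - a‖ ≤ ‖a‖ * Real.exp (μ (i + 1)) * μ (i + 1) :=
            norm_sub_le_thompson (hu _ (by omega)) ha
        _ ≤ ‖a‖ * Real.exp (μ 1) * (r ^ i * μ 1) := by
            refine mul_le_mul ?_ (hgeo i) (hμ0 _) (by positivity)
            exact mul_le_mul_of_nonneg_left (Real.exp_le_exp.2 (hdec i)) (norm_nonneg _)
        _ = ‖a‖ * Real.exp (μ 1) * μ 1 / r * r ^ (i + 1) 
            := by field_simp; ring
        _ ≤ _ := mul_le_mul_of_nonneg_right (by linarith [norm_nonneg (u 0 - a)]) (by positivity)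
  refine ⟨hlin, ⟨θ, contractionFactor_nonneg hc _, contractionFactor_lt_one hc _, hstep⟩, ?_⟩
  have hμlim : Tendsto (fun i => μ (i + 1)) atTop (𝓝 0) := by
    have hgeo : ∀ i, μ (i + 1) ≤ θ ^ i * μ 1 := by
      intro i
      induction i with
      | zero => simp
      | succ i ih =>
        calc μ (i + 1 + 1) ≤ θ * μ (i + 1) := hstep _ (by omega)
          _ ≤ θ * (θ ^ i * μ 1) := mul_le_mul_of_nonneg_left ih (contractionFactor_nonneg hc _)
          _ = θ ^ (i + 1) * μ 1 := by ring
    refine squeeze_zero (fun i => hμ0 _) hgeo ?_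
    simpa using (tendsto_pow_atTop_nhds_zero_of_lt_one (contractionFactor_nonneg hc (μ 1))
      (contractionFactor_lt_one hc _)).mul_const (μ 1)
  have hcf : Tendsto (fun i => contractionFactor c (μ i)) atTop (𝓝 (c / (1 + c))) := by
    have hcont : ContinuousAt (contractionFactor c) 0 := by
      unfold contractionFactor
      refine ContinuousAt.div (by fun_prop) (by fun_prop) (by positivity)
    have h0 : contractionFactor c 0 = c / (1 + c) := by simp [contractionFactor]
    rw [← h0]
    exact hcont.tendsto.comp ((tendsto_add_atTop_iff_nat 1).1 hμlim)
  have hE : Tendsto (fun i => ((contractionFactor c (μ i) : ℝ) : EReal)) atTop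
      (𝓝 ((c / (1 + c) : ℝ) : EReal)) := (continuous_coe_real_ereal.tendsto _).comp hcf
  rw [← hE.limsup_eq]
  refine limsup_le_limsup ?_
  filter_upwards [eventually_ge_atTop 1] with i hi
  exact_mod_cast div_le_of_le_mul₀ (hμ0 i) (contractionFactor_nonneg hc _) (h i hi)

end Thompson

/-! ### Weak duality -/

section Trace

variable {n : ℕ}

lemma re_trace_mul_vecMulVec (A : Matrix (Fin n) (Fin n) ℂ) (v : Fin n → ℂ) :
    (trace (A * vecMulVec v (star v))).re = hform A v := by
  rw [mul_vecMulVec, trace_vecMulVec, dotProduct_comm, hform]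

lemma re_trace_mul_smul (A B : Matrix (Fin n) (Fin n) ℂ) (r : ℝ) :
    (trace (A * ((r : ℂ) • B))).re = r * (trace (A * B)).re := by
  rw [Matrix.mul_smul, trace_smul, smul_eq_mul, Complex.re_ofReal_mul]

lemma trace_mul_single_diag (A : Matrix (Fin n) (Fin n) ℂ) (m : Fin n) (c : ℂ) :
    trace (A * Matrix.single m m c) = A m m * c := by
  rw [trace_mul_comm]
  simp [trace, Matrix.mul_apply, single_apply, ite_and, mul_comm]

open scoped MatrixOrder Matrix.Norms.L2Operator in
lemma Matrix.PosSemidef.re_trace_mul_nonneg {A B : Matrix (Fin n) (Fin n) ℂ}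
    (hA : A.PosSemidef) (hB : B.PosSemidef) : 0 ≤ (trace (A * B)).re := by
  obtain ⟨R, rfl⟩ := CStarAlgebra.nonneg_iff_eq_star_mul_self.1 hA.nonneg
  rw [star_eq_conjTranspose, Matrix.mul_assoc, trace_mul_comm]
  exact (Complex.nonneg_iff.1 (hB.mul_mul_conjTranspose_same R).trace_nonneg).1

end Trace

namespace Network

variable {M K : ℕ} {N : Network M K}

lemma re_trace_mul_Γ (Q : Matrix (Fin M) (Fin M) ℂ) (β : Fin K → ℝ) :
    (trace (Q * N.Γ β)).re = (trace Q).re + ∑ k, β k * hform Q (N.h k) := by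
  simp only [Γ, Matrix.mul_add, Matrix.mul_one, Matrix.mul_sum, trace_add, trace_sum,
    Complex.add_re, Complex.re_sum, re_trace_mul_smul, hh, re_trace_mul_vecMulVec]

lemma Λ_apply_eq_zero (β : Fin K → ℝ) {m i j : Fin M} (h : i < m ∨ j < m) : N.Λ β m i j = 0 := by
  simp only [Λ, lambdaOf, of_apply, if_pos h]

lemma lamVec_apply_eq_zero (β : Fin K → ℝ) {m i : Fin M} (h : i < m) : N.lamVec β m i = 0 := by
  rw [lamVec, Λ_apply_eq_zero β (Or.inl h), zero_div]

lemma ofReal_sqrt_mul_self {r : ℝ} (hr : 0 ≤ r) :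
    ((Real.sqrt r : ℝ) : ℂ) * ((Real.sqrt r : ℝ) : ℂ) = (r : ℂ) := by
  rw [← Complex.ofReal_mul, Real.mul_self_sqrt hr]

lemma lamVec_self (hC : ∀ m, 0 < N.C m) {β : Fin K → ℝ} (hβ : 0 ≤ β) (m : Fin M) :
    N.lamVec β m m = ((Real.sqrt (N.Λ β m m m).re : ℝ) : ℂ) := by
  have h := Λ_diag_pos hC hβ m
  have h0 : ((Real.sqrt (N.Λ β m m m).re : ℝ) : ℂ) ≠ 0 := by
    exact_mod_cast (Real.sqrt_pos.2 h).ne'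
  rw [lamVec, div_eq_iff h0, ofReal_sqrt_mul_self h.le, ofReal_re_Λ_diag hC hβ]

lemma norm_lamVec_self_sq (hC : ∀ m, 0 < N.C m) {β : Fin K → ℝ} (hβ : 0 ≤ β) (m : Fin M) :
    ‖N.lamVec β m m‖ ^ 2 = (N.Λ β m m m).re := by
  rw [lamVec_self hC hβ, Complex.norm_real, Real.norm_eq_abs, sq_abs,
    Real.sq_sqrt (Λ_diag_pos hC hβ m).le]

lemma Λ_eq_vecMulVec (hC : ∀ m, 0 < N.C m) {β : Fin K → ℝ} (hβ : 0 ≤ β) (m : Fin M) :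
    N.Λ β m = vecMulVec (N.lamVec β m) (star (N.lamVec β m)) := by
  have hA := isTailPosDef_residual hC hβ m m.isLt.le
  have hη := one_lt_η hC m
  have hpos := Λ_diag_pos hC hβ m
  have hl := ofReal_re_Λ_diag hC hβ m
  have hl0 : ((N.Λ β m m m).re : ℂ) ≠ 0 := by exact_mod_cast hpos.ne'
  have hs := ofReal_sqrt_mul_self hpos.le
  have hA0 : N.residual β m m m ≠ 0 := by
    rw [← hA.ofReal_re_diag]; exact_mod_cast hA.diag_pos.ne'
  have h0 : (N.η m : ℂ) ≠ 0 := by exact_mod_cast (by linarith : N.η m ≠ 0)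
  have h1 : (N.η m : ℂ) - 1 ≠ 0 := by exact_mod_cast (by linarith : N.η m - 1 ≠ 0)
  ext i j
  have key : vecMulVec (N.lamVec β m) (star (N.lamVec β m)) i j =
      N.Λ β m i m * star (N.Λ β m j m) / ((N.Λ β m m m).re : ℂ) := by
    rw [vecMulVec_apply, Pi.star_apply, lamVec, lamVec, star_div₀, ← hs, div_mul_div_comm]
    congr 2
    exact Complex.conj_ofReal _
  have hstar : star (N.Λ β m m m) = N.Λ β m m m := by
    rw [← hl]; exact Complex.conj_ofReal _
  have hcol : ∀ i, m < i → N.Λ β m i m = 1 / (N.η m : ℂ) * N.residual β m i m :=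
    fun i hi => lambdaOf_col hi _
  have hscol : ∀ i, m < i → star (N.Λ β m i m) = 1 / (N.η m : ℂ) * N.residual β m m i := by
    intro i hi
    rw [hcol i hi, star_mul', hA.isHermitian.apply]
    congr 1
    rw [one_div, star_inv₀]
    congr 1
    exact Complex.conj_ofReal _
  rw [key]
  rcases lt_trichotomy i m with hi | rfl | hi
  · rw [Λ_apply_eq_zero β (Or.inl hi), Λ_apply_eq_zero β (Or.inl hi)]; simp
  · rcases lt_trichotomy j i with hj | rfl | hj
    · rw [Λ_apply_eq_zero β (Or.inr hj), Λ_apply_eq_zero β (Or.inl hj)]; simp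
    · rw [hstar, hl, mul_div_assoc, div_self (hl ▸ hl0), mul_one]
    · rw [hscol j hj, hl, mul_div_cancel_left₀ _ (hl ▸ hl0)]
      simp [Λ, lambdaOf, hj.not_gt, hj.ne']
  · rcases lt_trichotomy j m with hj | rfl | hj
    · rw [Λ_apply_eq_zero β (Or.inr hj), Λ_apply_eq_zero β (Or.inl hj)]; simp
    · rw [hstar, hl, mul_div_assoc, div_self (hl ▸ hl0), mul_one]
    · rw [hscol j hj, hcol i hi, hl]
      rw [show N.Λ β m m m = 1 / ((N.η m : ℂ) - 1) * N.residual β m m m from lambdaOf_diag _ _]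
      simp only [Λ, lambdaOf, of_apply, hi.not_gt, hj.not_gt, hi.ne', hj.ne', or_self, if_false,
        and_self]
      field_simp

/-- The elimination writes `Γ(β)` as `∑ (η_m λ_m λ_m† - Λ_m^{(m,m)} E_m)`; here this identity is
paired with a matrix `Q`. -/
lemma re_trace_mul_Γ_eq_sum (hC : ∀ m, 0 < N.C m) {β : Fin K → ℝ} (hβ : 0 ≤ β)
    (Q : Matrix (Fin M) (Fin M) ℂ) :
    (trace Q).re + ∑ k, β k * hform Q (N.h k) =
      ∑ m, (N.η m * hform Q (N.lamVec β m) - (N.Λ β m m m).re * (Q m m).re) := by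
  have hstep : ∀ m : Fin M, (trace (Q * N.residual β m)).re -
      (trace (Q * N.residual β (m + 1))).re =
      N.η m * hform Q (N.lamVec β m) - (N.Λ β m m m).re * (Q m m).re := by
    intro m
    rw [residual_succ, residualStep, Matrix.mul_sub, Matrix.mul_sub, trace_sub, trace_sub,
      Complex.sub_re, Complex.sub_re, re_trace_mul_smul, trace_mul_single_diag]
    change _ - (_ - (_ * (trace (Q * N.Λ β m)).re - (Q m m * N.Λ β m m m).re)) = _
    rw [← ofReal_re_Λ_diag hC hβ, Complex.re_mul_ofReal, Complex.ofReal_re,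
      ← re_trace_mul_vecMulVec, ← Λ_eq_vecMulVec hC hβ]
    ring
  have htel := Finset.sum_range_sub' (fun i => (trace (Q * N.residual β i)).re) M
  rw [Finset.sum_range, residual_last hC hβ, residual, re_trace_mul_Γ] at htel
  simp only [hstep] at htel
  rw [htel]
  simp

lemma re_trace_mul_Cmat (hC : ∀ m, 0 < N.C m) {β : Fin K → ℝ} (hβ : 0 ≤ β) (k : Fin K)
    (V : Matrix (Fin M) (Fin M) ℂ) :
    (trace (V * N.Cmat β k)).re = (trace V).re
      + ∑ j ∈ Finset.univ.erase k, β j * hform V (N.h j)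
      + ∑ m, (N.Λ β m m m).re * (V m m).re := by
  have h : ∀ m, (V m m * N.Λ β m m m).re = (N.Λ β m m m).re * (V m m).re := by
    intro m
    rw [← ofReal_re_Λ_diag hC hβ, Complex.re_mul_ofReal, Complex.ofReal_re, mul_comm]
  simp only [Cmat, Matrix.mul_add, Matrix.mul_one, Matrix.mul_sum, trace_add, trace_sum,
    Complex.add_re, Complex.re_sum, re_trace_mul_smul, hh, re_trace_mul_vecMulVec,
    trace_mul_single_diag, h]

/-- If `β ≤ I(β)`, then `β` satisfies the dual constraint `C_k(β) ≽ (β_k / γ_k) h_k h_k†`. -/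
lemma posSemidef_Cmat_sub (hγ : ∀ k, 0 < N.γ k) (hC : ∀ m, 0 < N.C m) (hh : ∀ k, N.h k ≠ 0)
    {β : Fin K → ℝ} (hβ : 0 ≤ β) (hle : β ≤ N.dualMap β) (k : Fin K) :
    (N.Cmat β k - ((β k / N.γ k : ℝ) : ℂ) • N.hh k).PosSemidef := by
  have hP := Cmat_posDef hC hβ k
  refine IsHermitian.posSemidef_of_hform
    (hP.isHermitian.sub (ofReal_smul_isHermitian (hh_isHermitian k) _)) fun x => ?_
  rw [hform_sub, hform_smul, hform_hh]
  have h1 := hle k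
  rw [dualMap, le_div_iff₀ (hform_inv_Cmat_pos hC hh hβ k)] at h1
  have h2 := hP.norm_dotProduct_sq_le x (N.h k)
  rw [star_dotProduct, norm_star] at h2
  have h3 := hP.posSemidef.hform_nonneg x
  have h4 : β k * ‖star (N.h k) ⬝ᵥ x‖ ^ 2 ≤ N.γ k * hform (N.Cmat β k) x :=
    calc β k * ‖star (N.h k) ⬝ᵥ x‖ ^ 2
        ≤ β k * (hform (N.Cmat β k)⁻¹ (N.h k) * hform (N.Cmat β k) x) :=
          mul_le_mul_of_nonneg_left h2 (hβ k)
      _ = (β k * hform (N.Cmat β k)⁻¹ (N.h k)) * hform (N.Cmat β k) x := by ring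
      _ ≤ N.γ k * hform (N.Cmat β k) x := mul_le_mul_of_nonneg_right h1 h3
  rw [div_mul_eq_mul_div, sub_nonneg, div_le_iff₀ (hγ k)]
  linarith

lemma sum_eq_sum_subtype {α : Type*} [AddCommMonoid α] (p : Fin M → Prop) [DecidablePred p]
    (f : Fin M → α) (h : ∀ i, ¬ p i → f i = 0) : ∑ i, f i = ∑ i : {i // p i}, f i := by
  rw [← Fintype.sum_subtype_add_sum_subtype p f,
    Finset.sum_eq_zero (s := (Finset.univ : Finset {i // ¬ p i})) (fun i _ => h i i.2), add_zero]

/-- The fronthaul constraint tested on `λ_m`. -/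
lemma le_of_posDef_B (hC : ∀ m, 0 < N.C m) {β : Fin K → ℝ} (hβ : 0 ≤ β)
    {V : Fin K → Matrix (Fin M) (Fin M) ℂ} {Q : Matrix (Fin M) (Fin M) ℂ} {m : Fin M}
    (hB : ((N.B V Q m).submatrix (Subtype.val : {i : Fin M // m ≤ i} → Fin M)
      (Subtype.val : {i : Fin M // m ≤ i} → Fin M)).PosDef) :
    (N.Λ β m m m).re * ∑ k, (V k m m).re ≤
      N.η m * hform Q (N.lamVec β m) - (N.Λ β m m m).re * (Q m m).re := by
  set x := N.lamVec β m with hx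
  have hx0 : ∀ i, ¬ m ≤ i → x i = 0 := fun i hi => lamVec_apply_eq_zero β (not_le.1 hi)
  have h1 : 0 ≤ hform (N.B V Q m) x := by
    have := (Complex.nonneg_iff.1
      (hB.posSemidef.dotProduct_mulVec_nonneg fun i => x i.1)).1
    refine this.trans_eq ?_
    rw [hform]
    congr 1
    simp only [dotProduct, mulVec, submatrix_apply, Pi.star_apply]
    rw [sum_eq_sum_subtype (fun i => m ≤ i) _ (fun i hi => by rw [hx0 i hi]; simp)]
    refine Finset.sum_congr rfl fun i _ => ?_
    congr 1
    exact (sum_eq_sum_subtype (fun i => m ≤ i) (fun j => N.B V Q m i j * x j)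
      (fun j hj => by rw [hx0 j hj]; simp)).symm
  have h2 : hform (Matrix.of fun i j => if m ≤ i ∧ m ≤ j then Q i j else 0) x = hform Q x := by
    rw [hform, hform]
    congr 1
    simp only [dotProduct, mulVec, Pi.star_apply, of_apply]
    refine Finset.sum_congr rfl fun i _ => ?_
    by_cases hi : m ≤ i
    · congr 1
      refine Finset.sum_congr rfl fun j _ => ?_
      by_cases hj : m ≤ j
      · simp [hi, hj]
      · rw [hx0 j hj]; simp
    · rw [hx0 i hi]; simp
  rw [B, hform_sub, hform_smul, h2, hform_single, norm_lamVec_self_sq hC hβ, Complex.add_re,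
    Complex.re_sum] at h1
  linarith

lemma sum_sum_erase_comm (f : Fin K → Fin K → ℝ) :
    ∑ k, ∑ j ∈ Finset.univ.erase k, f k j = ∑ k, ∑ j ∈ Finset.univ.erase k, f j k := by
  have h : ∀ g : Fin K → ℝ, ∀ k, ∑ j ∈ Finset.univ.erase k, g j = ∑ j, g j - g k := fun g k =>
    Finset.sum_erase_eq_sub (Finset.mem_univ k)
  simp only [h, Finset.sum_sub_distrib]
  rw [Finset.sum_comm]

/-- Weak duality: every `β` with `β ≤ I(β)` is dual feasible, so that the dual objective is bounded
by the value of any primal feasible point. -/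
lemma sum_mul_sq_le (hγ : ∀ k, 0 < N.γ k) (hC : ∀ m, 0 < N.C m) (hh : ∀ k, N.h k ≠ 0)
    {V : Fin K → Matrix (Fin M) (Fin M) ℂ} {Q : Matrix (Fin M) (Fin M) ℂ}
    (hV : ∀ k, (V k).PosDef) (ha : ∀ k, 0 < N.a V Q k)
    (hB : ∀ m, ((N.B V Q m).submatrix (Subtype.val : {i : Fin M // m ≤ i} → Fin M)
      (Subtype.val : {i : Fin M // m ≤ i} → Fin M)).PosDef)
    {β : Fin K → ℝ} (hβ : 0 ≤ β) (hle : β ≤ N.dualMap β) :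
    ∑ k, β k * N.σ k ^ 2 ≤ ∑ k, (trace (V k)).re + (trace Q).re := by
  have h1 := re_trace_mul_Γ_eq_sum hC hβ Q
  have h2 : ∑ m, (N.Λ β m m m).re * ∑ k, (V k m m).re ≤
      ∑ m, (N.η m * hform Q (N.lamVec β m) - (N.Λ β m m m).re * (Q m m).re) :=
    Finset.sum_le_sum fun m _ => le_of_posDef_B hC hβ (hB m)
  have h3 : 0 ≤ ∑ k, ((trace (V k)).re + ∑ j ∈ Finset.univ.erase k, β j * hform (V k) (N.h j)
      + ∑ m, (N.Λ β m m m).re * (V k m m).re - β k / N.γ k * hform (V k) (N.h k)) := by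
    refine Finset.sum_nonneg fun k _ => ?_
    have := (hV k).posSemidef.re_trace_mul_nonneg (posSemidef_Cmat_sub hγ hC hh hβ hle k)
    rwa [Matrix.mul_sub, trace_sub, Complex.sub_re, re_trace_mul_smul, re_trace_mul_Cmat hC hβ,
      Network.hh, re_trace_mul_vecMulVec] at this
  have h4 : 0 ≤ ∑ k, β k * N.a V Q k :=
    Finset.sum_nonneg fun k _ => mul_nonneg (hβ k) (ha k).le
  have h5 : ∑ k, β k * N.a V Q k = ∑ k, β k / N.γ k * hform (V k) (N.h k)
      - ∑ k, ∑ j ∈ Finset.univ.erase k, β k * hform (V j) (N.h k)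
      - ∑ k, β k * hform Q (N.h k) - ∑ k, β k * N.σ k ^ 2 := by
    simp only [← Finset.sum_sub_distrib]
    refine Finset.sum_congr rfl fun k _ => ?_
    rw [a, ← Finset.mul_sum]
    ring
  rw [← sum_sum_erase_comm fun k j => β j * hform (V k) (N.h j)] at h5
  have h6 : ∑ m, (N.Λ β m m m).re * ∑ k, (V k m m).re =
      ∑ k, ∑ m, (N.Λ β m m m).re * (V k m m).re := by
    simp only [Finset.mul_sum]
    rw [Finset.sum_comm]
  simp only [Finset.sum_sub_distrib, Finset.sum_add_distrib] at h3
  rw [h6, Finset.sum_sub_distrib] at h2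
  rw [Finset.sum_sub_distrib] at h1
  linarith

lemma StrictlyFeasible.h_ne_zero (hf : N.StrictlyFeasible) (k : Fin K) :
    N.h k ≠ 0 := by
  obtain ⟨V, Q, -, -, ha, -⟩ := hf
  intro h
  have := ha k
  have h0 : ∀ A : Matrix (Fin M) (Fin M) ℂ, hform A 0 = 0 := fun A => by simp [hform]
  simp only [a, h, h0, mul_zero, Finset.sum_const_zero] at this
  have := sq_nonneg (N.σ k)
  linarith

lemma StrictlyFeasible.exists_fixedPoint (hγ : ∀ k, 0 < N.γ k) (hσ : ∀ k, 0 < N.σ k)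
    (hC : ∀ m, 0 < N.C m) (hf : N.StrictlyFeasible) :
    ∃ β : Fin K → ℝ, (∀ k, 0 < β k) ∧ N.dualMap β = β := by
  have hh := hf.h_ne_zero
  obtain ⟨V, Q, hV, -, ha, hB⟩ := hf
  refine (isStandardInterference_dualMap hγ hC hh).exists_fixedPoint
    (fun β hβ k => dualMap_pos hγ hC hh hβ k)
    (fun k => (∑ k, (trace (V k)).re + (trace Q).re) / N.σ k ^ 2) fun β hβ hle k => ?_
  rw [le_div_iff₀ (pow_pos (hσ k) 2)]
  refine le_trans ?_ (sum_mul_sq_le hγ hC hh hV ha hB hβ hle)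
  exact Finset.single_le_sum (f := fun k => β k * N.σ k ^ 2)
    (fun j _ => mul_nonneg (hβ j) (sq_nonneg _)) (Finset.mem_univ k)

end Network

/-! ### The quantization covariance `Q(p)` -/

namespace Network

variable {M K : ℕ} {N : Network M K}

lemma Vhat_diag (β : Fin K → ℝ) (k : Fin K) (m : Fin M) :
    N.Vhat β k m m = ((‖N.vhat β k m‖ ^ 2 : ℝ) : ℂ) := by
  rw [Vhat, vecMulVec_apply, Pi.star_apply, ← Complex.normSq_eq_norm_sq]
  exact Complex.mul_conj _

lemma hform_Vhat (β : Fin K → ℝ) (k : Fin K) (x : Fin M → ℂ) :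
    hform (N.Vhat β k) x = ‖star (N.vhat β k) ⬝ᵥ x‖ ^ 2 :=
  hform_vecMulVec _ _

lemma Qstep_add (β p q : Fin K → ℝ) (m : Fin M) (Q R : Matrix (Fin M) (Fin M) ℂ) :
    N.Qstep β (p + q) m (Q + R) = N.Qstep β p m Q + N.Qstep β q m R := by
  ext i j
  simp only [Qstep, of_apply, Matrix.add_apply, add_mulVec, Pi.add_apply, dotProduct_add,
    Complex.ofReal_add, add_mul, Finset.sum_add_distrib]
  split_ifs <;> first | ring1 | (simp; ring1)

lemma Qstep_smul (β p : Fin K → ℝ) (m : Fin M) (c : ℝ) (Q : Matrix (Fin M) (Fin M) ℂ) :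
    N.Qstep β (c • p) m ((c : ℂ) • Q) = (c : ℂ) • N.Qstep β p m Q := by
  ext i j
  simp only [Qstep, of_apply, Matrix.smul_apply, smul_mulVec, Pi.smul_apply, dotProduct_smul,
    Complex.ofReal_mul, smul_eq_mul, mul_assoc, ← Finset.mul_sum]
  split_ifs <;> first | ring1 | (simp; ring1)

lemma Qrec_add (β p q : Fin K → ℝ) (n : ℕ) :
    N.Qrec β (p + q) n = N.Qrec β p n + N.Qrec β q n := by
  induction n with
  | zero => simp [Qrec]
  | succ n ih =>
    simp only [Qrec]
    split_ifs
    · rw [ih, Qstep_add]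
    · exact ih

lemma Qrec_smul (β p : Fin K → ℝ) (c : ℝ) (n : ℕ) :
    N.Qrec β (c • p) n = (c : ℂ) • N.Qrec β p n := by
  induction n with
  | zero => simp [Qrec]
  | succ n ih =>
    simp only [Qrec]
    split_ifs
    · rw [ih, Qstep_smul]
    · exact ih

lemma hform_Qmat_eq_sum (β p : Fin K → ℝ) (x : Fin M → ℂ) :
    hform (N.Qmat β p) x = ∑ j, p j * hform (N.Qmat β (Pi.single j 1)) x := by
  let f : (Fin K → ℝ) →ₗ[ℝ] ℝ :=
    { toFun := fun p => hform (N.Qmat β p) x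
      map_add' := fun p q => by simp only [Qmat, Qrec_add, hform_add]
      map_smul' := fun c p => by simp only [Qmat, Qrec_smul, hform_smul]; rfl }
  have h := f.pi_apply_eq_sum_univ p
  refine h.trans (Finset.sum_congr rfl fun j _ => ?_)
  rw [smul_eq_mul]
  congr 2
  change hform (N.Qmat β _) x = _
  congr 2
  ext i
  simp [Pi.single_apply, eq_comm]

/-- The quotient of the tail of `λ_m` by its leading entry. -/
noncomputable def tailRatio (N : Network M K) (β : Fin K → ℝ) (m : Fin M) : Fin M → ℂ :=
  (N.lamVec β m m)⁻¹ • N.lamTail β m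

/-- The elimination matrix `1 - u e_m†`, where `u` is `tailRatio`. It maps `λ_m` to a multiple of
`e_m`. -/
noncomputable def elimMat (N : Network M K) (β : Fin K → ℝ) (m : Fin M) :
    Matrix (Fin M) (Fin M) ℂ :=
  1 - vecMulVec (N.tailRatio β m) (Pi.single m 1)

lemma elimMat_mulVec (β : Fin K → ℝ) (m : Fin M) (x : Fin M → ℂ) :
    N.elimMat β m *ᵥ x = x - x m • N.tailRatio β m := by
  rw [elimMat, sub_mulVec, one_mulVec, vecMulVec_mulVec]
  simp

/-- The Hermitian matrix `A` vanishes outside of the block with row and column indices `> m`. -/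
structure IsTailHermitian (m : Fin M) (A : Matrix (Fin M) (Fin M) ℂ) : Prop where
  isHermitian : A.IsHermitian
  apply_eq_zero : ∀ i j : Fin M, (i ≤ m ∨ j ≤ m) → A i j = 0

lemma IsTailHermitian.hform_congr {m : Fin M} {A : Matrix (Fin M) (Fin M) ℂ}
    (hA : IsTailHermitian m A) {x y : Fin M → ℂ} (h : ∀ i, m < i → x i = y i) :
    hform A x = hform A y := by
  have h1 : A *ᵥ x = A *ᵥ y := by
    ext i
    simp only [mulVec, dotProduct]
    refine Finset.sum_congr rfl fun j _ => ?_
    rcases le_or_gt j m with hj | hj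
    · rw [hA.apply_eq_zero i j (Or.inr hj), zero_mul, zero_mul]
    · rw [h j hj]
  rw [hform, hform, h1]
  congr 1
  simp only [dotProduct]
  refine Finset.sum_congr rfl fun i _ => ?_
  rcases le_or_gt i m with hi | hi
  · have : (A *ᵥ y) i = 0 := by
      simp only [mulVec, dotProduct]
      refine Finset.sum_eq_zero fun j _ => ?_
      rw [hA.apply_eq_zero i j (Or.inl hi), zero_mul]
    rw [this, mul_zero, mul_zero]
  · rw [Pi.star_apply, Pi.star_apply, h i hi]

/-- The new diagonal contribution in the recursion for `Q(p)`. -/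
noncomputable def newDiag (N : Network M K) (β p : Fin K → ℝ) (m : Fin M)
    (Q : Matrix (Fin M) (Fin M) ℂ) : ℝ :=
  (hform Q (N.tailRatio β m) + ∑ k, p k * (N.Vhat β k m m).re) / (N.η m - 1)

/-- The recursion step for `Q(p)` is a congruence plus a multiple of `E_m`. -/
lemma Qstep_eq (hC : ∀ m, 0 < N.C m) (β p : Fin K → ℝ) {m : Fin M}
    {Q : Matrix (Fin M) (Fin M) ℂ} (hQ : IsTailHermitian m Q) :
    N.Qstep β p m Q = (N.elimMat β m)ᴴ * Q * N.elimMat β m +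
      Matrix.single m m ((N.newDiag β p m Q : ℝ) : ℂ) := by
  have hη := one_lt_η hC m
  have h1 : (N.η m : ℂ) - 1 ≠ 0 := by exact_mod_cast (by linarith : N.η m - 1 ≠ 0)
  set u := N.tailRatio β m with hu
  set e : Fin M → ℂ := Pi.single m 1 with he
  set w := Q *ᵥ u with hw
  have hstare : star e = e := by rw [he, Pi.star_single, star_one]
  have hsw : star u ᵥ* Q = star w := by rw [hw, star_mulVec, hQ.isHermitian.eq]
  have hexp : (N.elimMat β m)ᴴ * Q * N.elimMat β m =
      Q - vecMulVec e (star w) - vecMulVec w e + vecMulVec ((star u ⬝ᵥ w) • e) e := by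
    rw [elimMat, ← hu, ← he, conjTranspose_sub, conjTranspose_one, conjTranspose_vecMulVec, hstare,
      Matrix.sub_mul, Matrix.one_mul, vecMulVec_mul, hsw, Matrix.mul_sub, Matrix.mul_one,
      Matrix.sub_mul, mul_vecMulVec, mul_vecMulVec, ← hw, vecMulVec_mulVec, ← hsw,
      ← dotProduct_mulVec, ← hw, op_smul_eq_smul]
    abel
  have hw0 : ∀ i, i ≤ m → w i = 0 := fun i hi => by
    simp only [hw, mulVec, dotProduct]
    refine Finset.sum_eq_zero fun j _ => ?_
    rw [hQ.apply_eq_zero i j (Or.inl hi), zero_mul]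
  have hwt : ∀ i, (Q *ᵥ N.lamTail β m) i / N.lamVec β m m = w i := fun i => by
    rw [hw, hu, tailRatio, mulVec_smul, Pi.smul_apply, smul_eq_mul, div_eq_inv_mul]
  have hform_u : (star (N.lamTail β m) ⬝ᵥ Q *ᵥ N.lamTail β m)
      / ((‖N.lamVec β m m‖ ^ 2 : ℝ) : ℂ) = ((hform Q u : ℝ) : ℂ) := by
    rw [hu, tailRatio, hform_smul_vec, hQ.isHermitian.ofReal_hform, norm_inv]
    push_cast
    rw [inv_pow, div_eq_inv_mul]
  have huw : star u ⬝ᵥ w = ((hform Q u : ℝ) : ℂ) := hQ.isHermitian.ofReal_hform u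
  have hV : ∑ k, (p k : ℂ) * N.Vhat β k m m = ((∑ k, p k * (N.Vhat β k m m).re : ℝ) : ℂ) := by
    push_cast
    refine Finset.sum_congr rfl fun k _ => ?_
    rw [Vhat_diag, Complex.ofReal_re]
  rw [hexp]
  ext i j
  simp only [Qstep, of_apply, Matrix.add_apply, Matrix.sub_apply, vecMulVec_apply, hwt, hform_u, hV,
    huw, Pi.star_apply, Pi.smul_apply, smul_eq_mul, star_neg, newDiag, ← hu]
  rcases lt_trichotomy i m with hi | rfl | hi
  · simp [hi.not_gt, hi.ne, hQ.apply_eq_zero i j (Or.inl hi.le), he, hw0 i hi.le, hi.ne']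
  · rcases lt_trichotomy j i with hj | rfl | hj
    · simp [hj.not_gt, hj.ne, hQ.apply_eq_zero i j (Or.inr hj.le), he, hw0 j hj.le, hj.ne']
    · simp [hQ.apply_eq_zero j j (Or.inr le_rfl), he, hw0 j le_rfl]
      field_simp
      ring
    · simp [hj, hj.ne', hQ.apply_eq_zero i j (Or.inl le_rfl), he, hw0 i le_rfl, hj.ne]
  · rcases lt_trichotomy j m with hj | rfl | hj
    · simp [hi, hi.ne', hj.not_gt, hj.ne, hQ.apply_eq_zero i j (Or.inr hj.le), he, hj.ne']
    · simp [hi, hi.ne', hQ.apply_eq_zero i j (Or.inr le_rfl), he, hi.ne]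
    · simp [hi, hj, hi.ne', hj.ne', he, hi.ne]

lemma hform_Qstep (hC : ∀ m, 0 < N.C m) (β p : Fin K → ℝ) {m : Fin M}
    {Q : Matrix (Fin M) (Fin M) ℂ} (hQ : IsTailHermitian m Q) (x : Fin M → ℂ) :
    hform (N.Qstep β p m Q) x =
      hform Q (x - x m • N.tailRatio β m) + N.newDiag β p m Q * ‖x m‖ ^ 2 := by
  rw [Qstep_eq hC β p hQ, hform_add, hform_conj, hform_single, elimMat_mulVec, Complex.ofReal_re]

lemma Qrec_succ (β p : Fin K → ℝ) {n : ℕ} (hn : n < M) :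
    N.Qrec β p (n + 1) = N.Qstep β p (Fin.rev ⟨n, hn⟩) (N.Qrec β p n) := by
  rw [Qrec, dif_pos hn]

lemma Qrec_succ_eq (β p : Fin K → ℝ) (m : Fin M) :
    N.Qrec β p (M - m) = N.Qstep β p m (N.Qrec β p (M - 1 - m)) := by
  have h : M - (m : ℕ) = (M - 1 - m) + 1 := by have := m.isLt; omega
  have hlt : M - 1 - (m : ℕ) < M := by have := m.isLt; omega
  rw [h, Qrec_succ β p hlt]
  congr 1
  ext
  simp only [Fin.val_rev]
  have := m.isLt
  omega

lemma Qrec_isHermitian_and_apply_eq_zero (hC : ∀ m, 0 < N.C m) (β p : Fin K → ℝ) (n : ℕ)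
    (hn : n ≤ M) : (N.Qrec β p n).IsHermitian ∧
      ∀ i j : Fin M, (i.val < M - n ∨ j.val < M - n) → N.Qrec β p n i j = 0 := by
  induction n with
  | zero => exact ⟨isHermitian_zero, fun i j _ => rfl⟩
  | succ n ih =>
    obtain ⟨ih1, ih2⟩ := ih (by omega)
    have hm : (Fin.rev ⟨n, hn⟩ : Fin M).val = M - (n + 1) := Fin.val_rev _
    rw [Qrec_succ β p hn]
    set m : Fin M := Fin.rev ⟨n, hn⟩
    have hQ : IsTailHermitian m (N.Qrec β p n) := ⟨ih1, fun i j hij => ih2 i j (by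
      rw [Fin.le_def, Fin.le_def] at hij; omega)⟩
    constructor
    · rw [Qstep_eq hC β p hQ]
      refine (isHermitian_conjTranspose_mul_mul _ ih1).add ?_
      rw [IsHermitian, conjTranspose_single]
      congr 1
      exact Complex.conj_ofReal _
    · intro i j hij
      have h1 : ¬ (m < i ∧ m < j) := by rw [Fin.lt_def, Fin.lt_def]; omega
      have h2 : ¬ (m < i ∧ j = m) := by rw [Fin.lt_def, Fin.ext_iff]; omega
      have h3 : ¬ (i = m ∧ m < j) := by rw [Fin.lt_def, Fin.ext_iff]; omega
      have h4 : ¬ (i = m ∧ j = m) := by rw [Fin.ext_iff, Fin.ext_iff]; omega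
      simp only [Qstep, of_apply, if_neg h1, if_neg h2, if_neg h3, if_neg h4]

lemma isTailHermitian_Qrec (hC : ∀ m, 0 < N.C m) (β p : Fin K → ℝ) (m : Fin M) :
    IsTailHermitian m (N.Qrec β p (M - 1 - m)) := by
  obtain ⟨h1, h2⟩ := Qrec_isHermitian_and_apply_eq_zero hC β p (M - 1 - m) (by omega)
  refine ⟨h1, fun i j hij => h2 i j ?_⟩
  have := m.isLt
  rw [Fin.le_def, Fin.le_def] at hij
  omega

lemma newDiag_nonneg (hC : ∀ m, 0 < N.C m) {β p : Fin K → ℝ} (hp : 0 ≤ p) (m : Fin M)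
    {Q : Matrix (Fin M) (Fin M) ℂ} (hQ : ∀ x, 0 ≤ hform Q x) : 0 ≤ N.newDiag β p m Q := by
  refine div_nonneg (add_nonneg (hQ _) (Finset.sum_nonneg fun k _ => mul_nonneg (hp k) ?_))
    (sub_pos.2 (one_lt_η hC m)).le
  rw [Vhat_diag, Complex.ofReal_re]
  positivity

lemma hform_Qrec_nonneg (hC : ∀ m, 0 < N.C m) (β : Fin K → ℝ) {p : Fin K → ℝ} (hp : 0 ≤ p)
    (n : ℕ) (hn : n ≤ M) (x : Fin M → ℂ) : 0 ≤ hform (N.Qrec β p n) x := by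
  induction n generalizing x with
  | zero => simp [Qrec]
  | succ n ih =>
    have hm : (Fin.rev ⟨n, hn⟩ : Fin M).val = M - (n + 1) := Fin.val_rev _
    rw [Qrec_succ β p hn]
    set m : Fin M := Fin.rev ⟨n, hn⟩
    have hQ := isTailHermitian_Qrec (N := N) hC β p m
    rw [show M - 1 - (m : ℕ) = n by omega] at hQ
    rw [hform_Qstep hC β p hQ]
    exact add_nonneg (ih (by omega) _)
      (mul_nonneg (newDiag_nonneg hC hp m (ih (by omega))) (by positivity))

lemma hform_Qmat_nonneg (hC : ∀ m, 0 < N.C m) (β : Fin K → ℝ) {p : Fin K → ℝ} (hp : 0 ≤ p)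
    (x : Fin M → ℂ) : 0 ≤ hform (N.Qmat β p) x :=
  hform_Qrec_nonneg hC β hp M le_rfl x

/-- Later steps of the recursion do not change the block that is already known. -/
lemma Qrec_apply_of_le (β p : Fin K → ℝ) {n n' : ℕ} (h : n ≤ n') (hn' : n' ≤ M) {i j : Fin M}
    (hi : M - n ≤ i) (hj : M - n ≤ j) : N.Qrec β p n' i j = N.Qrec β p n i j := by
  induction n', h using Nat.le_induction with
  | base => rfl
  | succ n' hle ih =>
    have hm : (Fin.rev ⟨n', hn'⟩ : Fin M).val = M - (n' + 1) := Fin.val_rev _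
    rw [Qrec_succ β p hn', ← ih (by omega)]
    have : Fin.rev ⟨n', hn'⟩ < i ∧ Fin.rev ⟨n', hn'⟩ < j := by
      rw [Fin.lt_def, Fin.lt_def]; omega
    simp only [Qstep, of_apply, if_pos this]

lemma hform_Qmat_eq_hform_Qstep (β p : Fin K → ℝ) (m : Fin M) {x : Fin M → ℂ}
    (hx : ∀ i, i < m → x i = 0) :
    hform (N.Qmat β p) x = hform (N.Qstep β p m (N.Qrec β p (M - 1 - m))) x := by
  rw [← Qrec_succ_eq, hform, hform]
  congr 1
  simp only [mulVec, dotProduct]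
  refine Finset.sum_congr rfl fun i _ => ?_
  rcases lt_or_ge i m with hi | hi
  · rw [Pi.star_apply, hx i hi, star_zero, zero_mul, zero_mul]
  · congr 1
    refine Finset.sum_congr rfl fun j _ => ?_
    rcases lt_or_ge j m with hj | hj
    · rw [hx j hj, mul_zero, mul_zero]
    · rw [Qmat, Qrec_apply_of_le β p (show M - (m : ℕ) ≤ M by omega) le_rfl
        (by have := m.isLt; rw [Fin.le_def] at hi; omega)
        (by have := m.isLt; rw [Fin.le_def] at hj; omega)]

/-- Complementary slackness `λ_m† B_m λ_m = 0` of `Q(p)` with the dual variables. -/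
lemma complementary_slackness (hC : ∀ m, 0 < N.C m) {β : Fin K → ℝ} (hβ : 0 ≤ β)
    (p : Fin K → ℝ) (m : Fin M) :
    N.η m * hform (N.Qmat β p) (N.lamVec β m) - (N.Λ β m m m).re * (N.Qmat β p m m).re =
      (N.Λ β m m m).re * ∑ k, p k * (N.Vhat β k m m).re := by
  have hQ := isTailHermitian_Qrec (N := N) hC β p m
  have hpos := Λ_diag_pos hC hβ m
  have hl0 : N.lamVec β m m ≠ 0 := by
    rw [lamVec_self hC hβ]; exact_mod_cast (Real.sqrt_pos.2 hpos).ne'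
  have h1 := hform_Qmat_eq_hform_Qstep (N := N) β p m (x := N.lamVec β m)
    (fun i hi => lamVec_apply_eq_zero β hi)
  have h2 := hform_Qmat_eq_hform_Qstep (N := N) β p m (x := Pi.single m 1)
    (fun i hi => Pi.single_eq_of_ne hi.ne _)
  rw [hform_Qstep hC β p hQ] at h1 h2
  have h3 : hform (N.Qrec β p (M - 1 - m)) (N.lamVec β m - N.lamVec β m m • N.tailRatio β m) =
      0 := by
    rw [hQ.hform_congr (y := 0) fun i hi => ?_]
    · simp [hform]
    · rw [Pi.sub_apply, tailRatio, smul_inv_smul₀ hl0, lamTail, if_pos hi, sub_self]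
      rfl
  have h4 : hform (N.Qrec β p (M - 1 - m)) (Pi.single m 1 -
      (Pi.single m 1 : Fin M → ℂ) m • N.tailRatio β m) =
      hform (N.Qrec β p (M - 1 - m)) (N.tailRatio β m) := by
    rw [hQ.hform_congr (y := (-1 : ℂ) • N.tailRatio β m) fun i hi => ?_, hform_smul_vec]
    · simp
    · simp [hi.ne']
  rw [h3, norm_lamVec_self_sq hC hβ] at h1
  rw [h4, hform_single_vec, Pi.single_eq_same, norm_one] at h2
  have hη : N.η m - 1 ≠ 0 := (sub_pos.2 (one_lt_η hC m)).ne'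
  rw [h1, h2, newDiag]
  field_simp
  ring

end Network

/-! ### Affine mappings with a nonnegative matrix -/

section NonnegMatrix

variable {K : ℕ} {G : Matrix (Fin K) (Fin K) ℝ} {b w : Fin K → ℝ}

lemma mulVec_nonneg_of_nonneg (hG : ∀ i j, 0 ≤ G i j) {x : Fin K → ℝ} (hx : 0 ≤ x) :
    0 ≤ G *ᵥ x := fun i => by
  simp only [mulVec, dotProduct]
  exact Finset.sum_nonneg fun j _ => mul_nonneg (hG i j) (hx j)

lemma mulVec_mono_of_nonneg (hG : ∀ i j, 0 ≤ G i j) {x y : Fin K → ℝ} (h : x ≤ y) :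
    G *ᵥ x ≤ G *ᵥ y := fun i => by
  simp only [mulVec, dotProduct]
  exact Finset.sum_le_sum fun j _ => mul_le_mul_of_nonneg_left (h j) (hG i j)

lemma isStandardInterference_affine (hG : ∀ i j, 0 ≤ G i j) (hb : ∀ k, 0 < b k) :
    IsStandardInterference fun p => G *ᵥ p + b where
  nonneg x hx := add_nonneg (mulVec_nonneg_of_nonneg hG hx) fun k => (hb k).le
  strictSubhomogeneous a ha x _ _ k := by
    have := mul_lt_mul_of_pos_right ha (hb k)
    rw [mulVec_smul]
    simp only [Pi.add_apply, Pi.smul_apply, smul_eq_mul]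
    linarith
  monotone x y _ h := add_le_add_left (mulVec_mono_of_nonneg hG h) b

/-- A positive vector `w` with `wᵀ G ≤ wᵀ - 1ᵀ` gives a fixed point of `p ↦ G p + b`. -/
lemma exists_fixedPoint_affine (hG : ∀ i j, 0 ≤ G i j) (hb : ∀ k, 0 < b k) (hw : ∀ k, 0 < w k)
    (h : ∀ x, 0 ≤ x → ∑ k, w k * (G *ᵥ x) k + ∑ k, x k ≤ ∑ k, w k * x k) :
    ∃ p, (∀ k, 0 < p k) ∧ G *ᵥ p + b = p := by
  refine (isStandardInterference_affine hG hb).exists_fixedPoint (fun x hx k =>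
    add_pos_of_nonneg_of_pos (mulVec_nonneg_of_nonneg hG hx k) (hb k))
    (fun _ => ∑ k, w k * b k) fun x hx hle k => ?_
  have h1 : ∑ k, w k * x k ≤ ∑ k, (w k * (G *ᵥ x) k + w k * b k) :=
    Finset.sum_le_sum fun k _ => by
      rw [← mul_add]; exact mul_le_mul_of_nonneg_left (hle k) (hw k).le
  rw [Finset.sum_add_distrib] at h1
  have h2 := h x hx
  have h3 := Finset.single_le_sum (f := x) (fun j _ => hx j) (Finset.mem_univ k)
  linarith

lemma iterate_affine_sub {p : Fin K → ℝ} (hp : G *ᵥ p + b = p) (x : Fin K → ℝ) (i : ℕ) :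
    (fun p => G *ᵥ p + b)^[i] x - p = (G ^ i) *ᵥ (x - p) := by
  induction i with
  | zero => simp
  | succ i ih =>
    rw [Function.iterate_succ_apply', pow_succ', ← mulVec_mulVec, ← ih, mulVec_sub]
    rw [← eq_sub_iff_add_eq] at hp
    rw [hp]
    abel

open scoped Matrix.Norms.Operator

lemma norm_eq_norm_mulVec_one (hG : ∀ i j, 0 ≤ G i j) : ‖G‖ = ‖G *ᵥ 1‖ := by
  rw [linfty_opNorm_def, Pi.norm_def]
  congr 2
  ext i
  have : (G *ᵥ 1) i = ∑ j, G i j := by simp [mulVec, dotProduct]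
  rw [this, coe_nnnorm, Real.norm_of_nonneg (Finset.sum_nonneg fun j _ => hG i j)]
  push_cast
  exact Finset.sum_congr rfl fun j _ => Real.norm_of_nonneg (hG i j)

/-- Gelfand's formula for a real matrix. -/
lemma tendsto_ofReal_norm_pow (G : Matrix (Fin K) (Fin K) ℝ) :
    Tendsto (fun n : ℕ => ENNReal.ofReal (‖G ^ n‖ ^ (1 / n : ℝ))) atTop
      (𝓝 (spectralRadius ℂ (G.map (algebraMap ℝ ℂ)))) := by
  have hnorm : ∀ A : Matrix (Fin K) (Fin K) ℝ, ‖A.map (algebraMap ℝ ℂ)‖ = ‖A‖ := fun A => by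
    simp [linfty_opNorm_def]
  have h := spectrum.pow_norm_pow_one_div_tendsto_nhds_spectralRadius (G.map (algebraMap ℝ ℂ))
  refine h.congr fun n => ?_
  rw [← hnorm, Matrix.map_pow]

lemma norm_pow_le_of_weight (hG : ∀ i j, 0 ≤ G i j) (hw : ∀ k, 0 < w k)
    (h : ∀ x, 0 ≤ x → ∑ k, w k * (G *ᵥ x) k + ∑ k, x k ≤ ∑ k, w k * x k) :
    ∃ C c : ℝ, 0 < C ∧ 0 ≤ c ∧ c < 1 ∧ ∀ n : ℕ, ‖G ^ n‖ ≤ C * c ^ n := by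
  set W := ∑ k, w k + 1 with hW
  have hwW : ∀ k, w k ≤ W := fun k => by
    have := Finset.single_le_sum (f := w) (fun j _ => (hw j).le) (Finset.mem_univ k)
    linarith
  have hsum : 0 ≤ ∑ k, w k := Finset.sum_nonneg fun k _ => (hw k).le
  have hW1 : 1 ≤ W := by linarith
  have hinv : 0 ≤ ∑ k, (w k)⁻¹ := Finset.sum_nonneg fun k _ => (inv_pos.2 (hw k)).le
  have hstep : ∀ x, 0 ≤ x → ∑ k, w k * (G *ᵥ x) k ≤ (1 - 1 / W) * ∑ k, w k * x k := by
    intro x hx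
    have h1 : ∑ k, w k * x k ≤ W * ∑ k, x k := by
      rw [Finset.mul_sum]
      exact Finset.sum_le_sum fun k _ => mul_le_mul_of_nonneg_right (hwW k) (hx k)
    have h2 : 1 / W * ∑ k, w k * x k ≤ ∑ k, x k := by
      rw [div_mul_eq_mul_div, one_mul, div_le_iff₀ (by linarith)]
      linarith
    have := h x hx
    linarith
  have hc0 : 0 ≤ 1 - 1 / W := by
    have : 1 / W ≤ 1 := (div_le_one (by linarith)).2 hW1
    linarith
  have hiter : ∀ n : ℕ, ∑ k, w k * ((G ^ n) *ᵥ 1) k ≤ (1 - 1 / W) ^ n * ∑ k, w k := by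
    intro n
    induction n with
    | zero => simp
    | succ n ih =>
      rw [pow_succ', ← mulVec_mulVec, pow_succ', mul_assoc]
      exact (hstep _ (mulVec_nonneg_of_nonneg (pow_apply_nonneg hG n) zero_le_one)).trans
        (mul_le_mul_of_nonneg_left ih hc0)
  refine ⟨(∑ k, (w k)⁻¹) * ∑ k, w k + 1, 1 - 1 / W, by positivity, hc0, ?_, fun n => ?_⟩
  · have : 0 < 1 / W := by positivity
    linarith
  rw [norm_eq_norm_mulVec_one (pow_apply_nonneg hG n)]
  have hcn : 0 ≤ (1 - 1 / W) ^ n := pow_nonneg hc0 n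
  refine (pi_norm_le_iff_of_nonneg (by positivity)).2 fun k => ?_
  have hnn := mulVec_nonneg_of_nonneg (pow_apply_nonneg hG n) (zero_le_one (α := Fin K → ℝ))
  rw [Real.norm_of_nonneg (hnn k)]
  have h1 : w k * ((G ^ n) *ᵥ 1) k ≤ (1 - 1 / W) ^ n * ∑ k, w k :=
    (Finset.single_le_sum (f := fun k => w k * ((G ^ n) *ᵥ 1) k)
      (fun j _ => mul_nonneg (hw j).le (hnn j)) (Finset.mem_univ k)).trans (hiter n)
  have h2 : (w k)⁻¹ ≤ ∑ k, (w k)⁻¹ :=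
    Finset.single_le_sum (f := fun k => (w k)⁻¹) (fun j _ => (inv_pos.2 (hw j)).le)
      (Finset.mem_univ k)
  have hrhs : 0 ≤ (1 - 1 / W) ^ n * ∑ k, w k := mul_nonneg hcn hsum
  calc ((G ^ n) *ᵥ 1) k = (w k)⁻¹ * (w k * ((G ^ n) *ᵥ 1) k) := by
        rw [inv_mul_cancel_left₀ (hw k).ne']
    _ ≤ (∑ k, (w k)⁻¹) * ((1 - 1 / W) ^ n * ∑ k, w k) :=
        mul_le_mul h2 h1 (mul_nonneg (hw k).le (hnn k)) hinv
    _ ≤ ((∑ k, (w k)⁻¹) * ∑ k, w k + 1) * (1 - 1 / W) ^ n := by linarith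

lemma spectralRadius_lt_one_of_weight (hG : ∀ i j, 0 ≤ G i j) (hw : ∀ k, 0 < w k)
    (h : ∀ x, 0 ≤ x → ∑ k, w k * (G *ᵥ x) k + ∑ k, x k ≤ ∑ k, w k * x k) :
    spectralRadius ℂ (G.map (algebraMap ℝ ℂ)) < 1 := by
  obtain ⟨C, c, hC, hc0, hc1, hle⟩ := norm_pow_le_of_weight hG hw h
  have hlim : Tendsto (fun n : ℕ => ENNReal.ofReal (C ^ (1 / n : ℝ) * c)) atTop
      (𝓝 (ENNReal.ofReal (1 * c))) := by
    refine ENNReal.tendsto_ofReal (Tendsto.mul_const c ?_)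
    have := (tendsto_const_nhds (x := C)).rpow (tendsto_one_div_atTop_nhds_zero_nat (𝕜 := ℝ))
      (Or.inl hC.ne')
    rwa [Real.rpow_zero] at this
  have h1 := le_of_tendsto_of_tendsto (tendsto_ofReal_norm_pow G) hlim (by
    filter_upwards [eventually_ge_atTop 1] with n hn
    refine ENNReal.ofReal_le_ofReal ?_
    have hn0 : (n : ℕ) ≠ 0 := by omega
    calc ‖G ^ n‖ ^ (1 / n : ℝ) ≤ (C * c ^ n) ^ (1 / n : ℝ) :=
          Real.rpow_le_rpow (norm_nonneg _) (hle n) (by positivity)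
      _ = C ^ (1 / n : ℝ) * c := by
          rw [Real.mul_rpow hC.le (by positivity), one_div, Real.pow_rpow_inv_natCast hc0 hn0])
  refine h1.trans_lt ?_
  rw [one_mul, ENNReal.ofReal_lt_one]
  exact hc1

lemma tendsto_norm_pow_toReal (hρ : spectralRadius ℂ (G.map (algebraMap ℝ ℂ)) < 1) :
    Tendsto (fun n : ℕ => ‖G ^ n‖ ^ (1 / n : ℝ)) atTop
      (𝓝 (spectralRadius ℂ (G.map (algebraMap ℝ ℂ))).toReal) := by
  refine ((ENNReal.tendsto_toReal (hρ.trans ENNReal.one_lt_top).ne).comp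
    (tendsto_ofReal_norm_pow G)).congr fun n => ?_
  exact ENNReal.toReal_ofReal (Real.rpow_nonneg (norm_nonneg _) _)

lemma exists_norm_pow_le (hρ : spectralRadius ℂ (G.map (algebraMap ℝ ℂ)) < 1) {r : ℝ}
    (hr : (spectralRadius ℂ (G.map (algebraMap ℝ ℂ))).toReal < r) :
    ∃ A : ℝ, ∀ n : ℕ, ‖G ^ n‖ ≤ A * r ^ n := by
  have hr0 : 0 < r := ENNReal.toReal_nonneg.trans_lt hr
  obtain ⟨n₀, hn₀⟩ := eventually_atTop.1
    ((tendsto_norm_pow_toReal hρ).eventually (gt_mem_nhds hr))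
  have hnn : ∀ n, 0 ≤ ‖G ^ n‖ / r ^ n := fun n => by positivity
  have hs : 0 ≤ ∑ n ∈ Finset.range (n₀ + 1), ‖G ^ n‖ / r ^ n := Finset.sum_nonneg fun n _ => hnn n
  refine ⟨1 + ∑ n ∈ Finset.range (n₀ + 1), ‖G ^ n‖ / r ^ n, fun n => ?_⟩
  rw [← div_le_iff₀ (by positivity)]
  rcases lt_or_ge n (n₀ + 1) with hn | hn
  · have := Finset.single_le_sum (f := fun n => ‖G ^ n‖ / r ^ n) (fun n _ => hnn n)
      (Finset.mem_range.2 hn)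
    linarith
  · have h1 := hn₀ n (by omega)
    have h2 : ‖G ^ n‖ ≤ r ^ n := by
      have := pow_le_pow_left₀ (Real.rpow_nonneg (norm_nonneg _) _) h1.le n
      rwa [one_div, Real.rpow_inv_natCast_pow (norm_nonneg _) (by omega)] at this
    have h3 : ‖G ^ n‖ / r ^ n ≤ 1 := (div_le_one (by positivity)).2 h2
    linarith

lemma exists_norm_iterate_affine_sub_le (hρ : spectralRadius ℂ (G.map (algebraMap ℝ ℂ)) < 1)
    {p : Fin K → ℝ} (hp : G *ᵥ p + b = p) {r : ℝ}
    (hr : (spectralRadius ℂ (G.map (algebraMap ℝ ℂ))).toReal < r) :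
    ∃ A : ℝ, ∀ (x : Fin K → ℝ) (i : ℕ),
      ‖(fun p => G *ᵥ p + b)^[i] x - p‖ ≤ A * r ^ i * ‖x - p‖ := by
  obtain ⟨A, hA⟩ := exists_norm_pow_le hρ hr
  refine ⟨A, fun x i => ?_⟩
  rw [iterate_affine_sub hp]
  exact (linfty_opNorm_mulVec _ _).trans (mul_le_mul_of_nonneg_right (hA i) (norm_nonneg _))

lemma convergesLinearly_iterate_affine (hρ : spectralRadius ℂ (G.map (algebraMap ℝ ℂ)) < 1)
    {p : Fin K → ℝ} (hp : G *ᵥ p + b = p) (x : Fin K → ℝ) :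
    ConvergesLinearly (fun i => (fun p => G *ᵥ p + b)^[i] x) p := by
  set ρ := (spectralRadius ℂ (G.map (algebraMap ℝ ℂ))).toReal
  have h0 : 0 ≤ ρ := ENNReal.toReal_nonneg
  have h1 : ρ < 1 := by
    have := (ENNReal.toReal_lt_toReal (hρ.trans ENNReal.one_lt_top).ne ENNReal.one_ne_top).2 hρ
    rwa [ENNReal.toReal_one] at this
  obtain ⟨A, hA⟩ := exists_norm_iterate_affine_sub_le hρ hp
    (r := (ρ + 1) / 2) (show ρ < (ρ + 1) / 2 by linarith)
  refine ⟨A * ‖x - p‖, (ρ + 1) / 2, by linarith, by linarith, fun i => (hA x i).trans_eq ?_⟩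
  ring

/-- Since `G` is nonnegative, the error of the iteration that starts at `p + 1` realizes the
operator norm of every power of `G`, and Gelfand's formula gives the exact rate. -/
lemma tendsto_norm_iterate_affine_sub (hG : ∀ i j, 0 ≤ G i j)
    (hρ : spectralRadius ℂ (G.map (algebraMap ℝ ℂ)) < 1)
    {p : Fin K → ℝ} (hp : G *ᵥ p + b = p) :
    Tendsto (fun i : ℕ => ‖(fun p => G *ᵥ p + b)^[i] (p + 1) - p‖ ^ (1 / (i : ℝ))) atTop
      (𝓝 (spectralRadius ℂ (G.map (algebraMap ℝ ℂ))).toReal) := by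
  refine (tendsto_norm_pow_toReal hρ).congr fun i => ?_
  rw [iterate_affine_sub hp, add_sub_cancel_left, norm_eq_norm_mulVec_one (pow_apply_nonneg hG i)]

end NonnegMatrix

/-! ### The primal mapping -/

namespace Network

variable {M K : ℕ} {N : Network M K}

lemma mulVec_inv_Cmat_ne_zero (hC : ∀ m, 0 < N.C m) (hh : ∀ k, N.h k ≠ 0) {β : Fin K → ℝ}
    (hβ : 0 ≤ β) (k : Fin K) : (N.Cmat β k)⁻¹ *ᵥ N.h k ≠ 0 := fun h => by
  have := hform_inv_Cmat_pos hC hh hβ k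
  rw [hform, h, dotProduct_zero, Complex.zero_re] at this
  exact lt_irrefl _ this

lemma norm_toLp_pos (hC : ∀ m, 0 < N.C m) (hh : ∀ k, N.h k ≠ 0) {β : Fin K → ℝ}
    (hβ : 0 ≤ β) (k : Fin K) : 0 < ‖WithLp.toLp 2 ((N.Cmat β k)⁻¹ *ᵥ N.h k)‖ := by
  rw [norm_pos_iff]
  exact fun h => mulVec_inv_Cmat_ne_zero hC hh hβ k (by simpa using h)

lemma norm_star_dotProduct_comm (x y : Fin M → ℂ) : ‖star x ⬝ᵥ y‖ = ‖star y ⬝ᵥ x‖ := by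
  rw [star_dotProduct, norm_star]

lemma hform_Vhat_comm (β : Fin K → ℝ) (j k : Fin K) :
    hform (N.Vhat β k) (N.h j) = ‖star (N.h j) ⬝ᵥ N.vhat β k‖ ^ 2 := by
  rw [hform_Vhat, norm_star_dotProduct_comm]

lemma hform_Vhat_self (hC : ∀ m, 0 < N.C m) {β : Fin K → ℝ} (hβ : 0 ≤ β) (k : Fin K) :
    hform (N.Vhat β k) (N.h k) = (‖WithLp.toLp 2 ((N.Cmat β k)⁻¹ *ᵥ N.h k)‖⁻¹) ^ 2 *
      hform (N.Cmat β k)⁻¹ (N.h k) ^ 2 := by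
  rw [hform_Vhat_comm, vhat, dotProduct_smul, (Cmat_posDef hC hβ k).inv.isHermitian.ofReal_hform,
    smul_eq_mul, norm_mul, mul_pow, Complex.norm_real, Complex.norm_real, Real.norm_eq_abs,
    Real.norm_eq_abs, sq_abs, sq_abs]

lemma hform_Vhat_self_pos (hC : ∀ m, 0 < N.C m) (hh : ∀ k, N.h k ≠ 0) {β : Fin K → ℝ}
    (hβ : 0 ≤ β) (k : Fin K) : 0 < hform (N.Vhat β k) (N.h k) := by
  rw [hform_Vhat_self hC hβ]
  have := norm_toLp_pos hC hh hβ k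
  have := hform_inv_Cmat_pos hC hh hβ k
  positivity

lemma sum_norm_vhat_sq (hC : ∀ m, 0 < N.C m) (hh : ∀ k, N.h k ≠ 0) {β : Fin K → ℝ}
    (hβ : 0 ≤ β) (k : Fin K) : ∑ i, ‖N.vhat β k i‖ ^ 2 = 1 := by
  have hpos := norm_toLp_pos hC hh hβ k
  have h1 : ∑ i, ‖N.vhat β k i‖ ^ 2 = ‖WithLp.toLp 2 (N.vhat β k)‖ ^ 2 :=
    (EuclideanSpace.norm_sq_eq (WithLp.toLp 2 (N.vhat β k))).symm
  rw [h1, vhat, WithLp.toLp_smul, norm_smul, Complex.norm_real, norm_inv, norm_norm,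
    inv_mul_cancel₀ hpos.ne', one_pow]

/-- At the fixed point `β`, the vector `v̂_k` lies in the kernel of
`C_k(β) - (β_k / γ_k) h_k h_k†`. -/
lemma one_add_sum_eq (hC : ∀ m, 0 < N.C m) (hγ : ∀ k, 0 < N.γ k) (hh : ∀ k, N.h k ≠ 0)
    {β : Fin K → ℝ} (hβ : 0 ≤ β) (hfix : N.dualMap β = β) (k : Fin K) :
    1 + ∑ j ∈ Finset.univ.erase k, β j * hform (N.Vhat β k) (N.h j)
      + ∑ m, (N.Λ β m m m).re * (N.Vhat β k m m).re =
      β k / N.γ k * hform (N.Vhat β k) (N.h k) := by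
  have h1 := hform_Cmat (N := N) β k (N.vhat β k)
  have h2 : hform (N.Cmat β k) (N.vhat β k) =
      β k / N.γ k * hform (N.Vhat β k) (N.h k) := by
    have hH := hform_inv_Cmat_pos hC hh hβ k
    rw [hform_Vhat_self hC hβ, vhat, hform_smul_vec, (Cmat_posDef hC hβ k).hform_mulVec_inv,
      Complex.norm_real, norm_inv, norm_norm]
    have h3 : β k = N.γ k / hform (N.Cmat β k)⁻¹ (N.h k) := (congrFun hfix k).symm
    rw [h3]
    have := (hγ k).ne'
    field_simp
  rw [sum_norm_vhat_sq hC hh hβ] at h1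
  rw [← h2, h1]
  simp only [Vhat_diag, Complex.ofReal_re, hform_Vhat_comm]

lemma primalMap_eq (β p : Fin K → ℝ) :
    N.primalMap β p = N.G β *ᵥ p + N.primalMap β 0 := by
  ext k
  have hQ0 : hform (N.Qmat β 0) (N.h k) = 0 := by
    rw [hform_Qmat_eq_sum]; simp
  have hG : ∀ j, N.G β k j * p j = N.γ k / hform (N.Vhat β k) (N.h k) *
      ((if j = k then 0 else p j * hform (N.Vhat β j) (N.h k)) +
        p j * hform (N.Qmat β (Pi.single j 1)) (N.h k)) := by
    intro j
    simp only [G, of_apply]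
    split_ifs with hj <;> ring
  have hs : ∑ j, (if j = k then 0 else p j * hform (N.Vhat β j) (N.h k)) =
      ∑ j ∈ Finset.univ.erase k, p j * hform (N.Vhat β j) (N.h k) := by
    rw [← Finset.add_sum_erase _ _ (Finset.mem_univ k), if_pos rfl, zero_add]
    exact Finset.sum_congr rfl fun j hj => if_neg (Finset.ne_of_mem_erase hj)
  rw [Pi.add_apply, mulVec, dotProduct]
  simp only [hG]
  rw [← Finset.mul_sum, Finset.sum_add_distrib, hs, ← hform_Qmat_eq_sum, primalMap, primalMap, hQ0]
  simp only [Pi.zero_apply, zero_mul, Finset.sum_const_zero]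
  ring

lemma G_nonneg (hγ : ∀ k, 0 < N.γ k) (hC : ∀ m, 0 < N.C m) (β : Fin K → ℝ) (k j : Fin K) :
    0 ≤ N.G β k j := by
  have h1 : ∀ i, 0 ≤ hform (N.Vhat β i) (N.h k) := fun i => by rw [hform_Vhat]; positivity
  have h2 : 0 ≤ hform (N.Qmat β (Pi.single j 1)) (N.h k) :=
    hform_Qmat_nonneg hC β (Pi.single_nonneg.2 zero_le_one) _
  have h3 := (hγ k).le
  have h4 := h1 j
  have h5 := h1 k
  simp only [G, of_apply]
  split_ifs
  · exact div_nonneg (mul_nonneg h3 h2) h5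
  · exact div_nonneg (mul_nonneg h3 (add_nonneg h4 h2)) h5

lemma primalMap_zero_pos (hγ : ∀ k, 0 < N.γ k) (hσ : ∀ k, 0 < N.σ k) (hC : ∀ m, 0 < N.C m)
    (hh : ∀ k, N.h k ≠ 0) {β : Fin K → ℝ} (hβ : 0 ≤ β) (k : Fin K) :
    0 < N.primalMap β 0 k := by
  have h1 := hform_Vhat_self_pos hC hh hβ k
  have h2 := hform_Qmat_nonneg hC β (le_refl (0 : Fin K → ℝ)) (N.h k)
  have h3 := hγ k
  have h4 := hσ k
  simp only [primalMap, Pi.zero_apply, zero_mul, Finset.sum_const_zero]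
  positivity

/-- Strong duality along the family `p`: with `w_k = β_k h_k† V̂_k h_k / γ_k`, the weighted slack
`wᵀ (p - G p)` equals the transmit power `∑ p_k + tr Q(p)`, which is at least `∑ p_k`. -/
lemma sum_weight_mulVec_le (hγ : ∀ k, 0 < N.γ k) (hC : ∀ m, 0 < N.C m)
    (hh : ∀ k, N.h k ≠ 0) {β : Fin K → ℝ} (hβ : 0 ≤ β) (hfix : N.dualMap β = β)
    {p : Fin K → ℝ} (hp : 0 ≤ p) :
    ∑ k, β k / N.γ k * hform (N.Vhat β k) (N.h k) * (N.G β *ᵥ p) k + ∑ k, p k ≤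
      ∑ k, β k / N.γ k * hform (N.Vhat β k) (N.h k) * p k := by
  have hG : ∀ k, β k / N.γ k * hform (N.Vhat β k) (N.h k) * (N.G β *ᵥ p) k =
      ∑ j ∈ Finset.univ.erase k, β k * (p j * hform (N.Vhat β j) (N.h k))
        + β k * hform (N.Qmat β p) (N.h k) := by
    intro k
    have h1 := congrFun (primalMap_eq (N := N) β p) k
    have hQ0 : hform (N.Qmat β 0) (N.h k) = 0 := by
      rw [hform_Qmat_eq_sum]; simp
    simp only [primalMap, Pi.add_apply, Pi.zero_apply, zero_mul, Finset.sum_const_zero, hQ0] at h1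
    have h2 := (hform_Vhat_self_pos hC hh hβ k).ne'
    have h3 := (hγ k).ne'
    rw [← sub_eq_iff_eq_add] at h1
    rw [← h1, ← Finset.mul_sum]
    field_simp
    ring
  have htr : (trace (N.Qmat β p)).re + ∑ k, β k * hform (N.Qmat β p) (N.h k) =
      ∑ k, p k * ∑ m, (N.Λ β m m m).re * (N.Vhat β k m m).re := by
    rw [re_trace_mul_Γ_eq_sum hC hβ]
    simp only [complementary_slackness hC hβ, Finset.mul_sum]
    rw [Finset.sum_comm]
    exact Finset.sum_congr rfl fun k _ => Finset.sum_congr rfl fun m _ => by ring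
  have htr0 : 0 ≤ (trace (N.Qmat β p)).re := by
    rw [trace, Complex.re_sum]
    refine Finset.sum_nonneg fun i _ => ?_
    rw [diag_apply, ← hform_single_vec]
    exact hform_Qmat_nonneg hC β hp _
  have hker : ∑ k, β k / N.γ k * hform (N.Vhat β k) (N.h k) * p k =
      ∑ k, p k + ∑ k, ∑ j ∈ Finset.univ.erase k, β j * (p k * hform (N.Vhat β k) (N.h j))
        + ∑ k, p k * ∑ m, (N.Λ β m m m).re * (N.Vhat β k m m).re := by
    rw [← Finset.sum_add_distrib, ← Finset.sum_add_distrib]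
    refine Finset.sum_congr rfl fun k _ => ?_
    rw [← one_add_sum_eq hC hγ hh hβ hfix k, add_mul, add_mul, one_mul, Finset.sum_mul,
      mul_comm (∑ m, _) (p k)]
    congr 2
    exact Finset.sum_congr rfl fun j _ => by ring
  rw [hker, ← htr, sum_sum_erase_comm fun k j => β j * (p k * hform (N.Vhat β k) (N.h j))]
  simp only [hG, Finset.sum_add_distrib]
  linarith

end Network

/-! ### Convergence of both iterations -/

open Network in
theorem theorem2 {M K : ℕ} (N : Network M K)
    (hγ : ∀ k, 0 < N.γ k) (hσ : ∀ k, 0 < N.σ k) (hC : ∀ m, 0 < N.C m)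
    (hfeas : N.StrictlyFeasible) :
    ∃ βs : Fin K → ℝ,
      -- `βs` is positive and is the unique fixed point of the dual mapping
      (∀ k, 0 < βs k) ∧ N.dualMap βs = βs ∧ (∀ β, 0 ≤ β → N.dualMap β = β → β = βs) ∧
      IsStandardInterference N.dualMap ∧
      -- the dual mapping is contractive in Thompson's metric
      (∀ β β' : Fin K → ℝ, (∀ k, 0 < β k) → (∀ k, 0 < β' k) → β ≠ β' →
        thompson (N.dualMap β) (N.dualMap β') < thompson β β') ∧
      -- convergence and linear convergence of the dual iteration from every starting point
      (∀ β0 : Fin K → ℝ, 0 ≤ β0 →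
        Tendsto (fun i : ℕ => N.dualMap^[i] β0) atTop (𝓝 βs) ∧
        ConvergesLinearly (fun i => N.dualMap^[i] β0) βs ∧
        (∃ c : ℝ, 0 ≤ c ∧ c < 1 ∧ ∀ i : ℕ, 1 ≤ i →
          thompson (N.dualMap^[i + 1] β0) βs ≤ c * thompson (N.dualMap^[i] β0) βs) ∧
        limsup (fun i : ℕ => ((thompson (N.dualMap^[i + 1] β0) βs /
            thompson (N.dualMap^[i] β0) βs : ℝ) : EReal)) atTop
          ≤ ((N.lam βs / (1 + N.lam βs) : ℝ) : EReal)) ∧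
      -- the primal mapping, built from the dual solution, is affine with nonnegative matrix `G`
      IsStandardInterference (N.primalMap βs) ∧
      (∀ k j, 0 ≤ N.G βs k j) ∧
      (∀ p, N.primalMap βs p = N.G βs *ᵥ p + N.primalMap βs 0) ∧
      N.rhoG βs < 1 ∧
      ∃ ps : Fin K → ℝ,
        -- `ps` is positive and is the unique fixed point of the primal mapping
        (∀ k, 0 < ps k) ∧ N.primalMap βs ps = ps ∧
        (∀ p, 0 ≤ p → N.primalMap βs p = p → p = ps) ∧
        -- convergence and linear convergence of the primal iteration from every starting point
        (∀ p0 : Fin K → ℝ, 0 ≤ p0 →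
          Tendsto (fun i : ℕ => (N.primalMap βs)^[i] p0) atTop (𝓝 ps) ∧
          ConvergesLinearly (fun i => (N.primalMap βs)^[i] p0) ps) ∧
        -- its rate is the spectral radius of `G`: every larger rate is achieved uniformly,
        (∀ r : ℝ, (N.rhoG βs).toReal < r → ∃ A : ℝ, ∀ p0 : Fin K → ℝ, 0 ≤ p0 → ∀ i : ℕ,
          ‖(N.primalMap βs)^[i] p0 - ps‖ ≤ A * r ^ i * ‖p0 - ps‖) ∧
        -- and from some starting point the rate is exactly the spectral radius
        (∃ p0 : Fin K → ℝ, 0 ≤ p0 ∧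
          Tendsto (fun i : ℕ => ‖(N.primalMap βs)^[i] p0 - ps‖ ^ (1 / (i : ℝ))) atTop
            (𝓝 (N.rhoG βs).toReal)) := by
  have hh := hfeas.h_ne_zero
  obtain ⟨βs, hpos, hfix⟩ := hfeas.exists_fixedPoint hγ hσ hC
  have hβs : 0 ≤ βs := fun k => (hpos k).le
  have hI := isStandardInterference_dualMap hγ hC hh
  have hIpos : ∀ β, 0 ≤ β → ∀ k, 0 < N.dualMap β k := fun β hβ => dualMap_pos hγ hC hh hβ
  have hcontr : ∀ β β' : Fin K → ℝ, (∀ k, 0 < β k) → (∀ k, 0 < β' k) → β ≠ β' →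
      thompson (N.dualMap β) (N.dualMap β') < thompson β β' := fun β β' h h' hne =>
    hI.thompson_lt hIpos h h' hne
  have hG := G_nonneg hγ hC βs
  have hb := primalMap_zero_pos hγ hσ hC hh hβs
  have hw : ∀ k, 0 < βs k / N.γ k * hform (N.Vhat βs k) (N.h k) := fun k =>
    mul_pos (div_pos (hpos k) (hγ k)) (hform_Vhat_self_pos hC hh hβs k)
  have hweight := fun p (hp : 0 ≤ p) => sum_weight_mulVec_le hγ hC hh hβs hfix hp
  have hJ : N.primalMap βs = fun p => N.G βs *ᵥ p + N.primalMap βs 0 :=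
    funext (primalMap_eq βs)
  have hρ : N.rhoG βs < 1 := spectralRadius_lt_one_of_weight hG hw hweight
  obtain ⟨ps, hps, hpfix⟩ := exists_fixedPoint_affine hG hb hw hweight
  have hlin : ∀ p0, ConvergesLinearly (fun i => (N.primalMap βs)^[i] p0) ps := fun p0 => by
    rw [hJ]; exact convergesLinearly_iterate_affine hρ hpfix p0
  refine ⟨βs, hpos, hfix, fun β hβ hβfix => ?_, hI, hcontr, fun β0 hβ0 => ?_, ?_, hG,
    primalMap_eq βs, hρ, ps, hps, ?_, fun p _ hp => ?_,
    fun p0 _ => ⟨(hlin p0).tendsto, hlin p0⟩, fun r hr => ?_, ⟨ps + 1, ?_, ?_⟩⟩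
  · by_contra hne
    have hβpos : ∀ k, 0 < β k := fun k => hβfix ▸ hIpos β hβ k
    have := hcontr β βs hβpos hpos hne
    rw [hβfix, hfix] at this
    exact lt_irrefl _ this
  · have hit : ∀ i, 0 ≤ N.dualMap^[i] β0 := by
      intro i
      induction i with
      | zero => exact hβ0
      | succ i ih => rw [Function.iterate_succ_apply']; exact hI.nonneg _ ih
    have hitpos : ∀ i, 1 ≤ i → ∀ k, 0 < (N.dualMap^[i] β0) k := by
      intro i hi
      obtain ⟨j, rfl⟩ := Nat.exists_eq_add_of_le' hi
      rw [Function.iterate_succ_apply']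
      exact hIpos _ (hit j)
    obtain ⟨h1, h2, h3⟩ := convergence_of_thompson_le (u := fun i => N.dualMap^[i] β0)
      (lam_nonneg (N := N) βs) hpos hitpos (fun i hi => by
        rw [Function.iterate_succ_apply']
        refine thompson_map_le (lam_nonneg βs) (hitpos i hi) (hIpos _ (hit i)) hpos
          (fun t ht hle k => ?_) (fun t ht hle k => ?_)
        · have := dualMap_le_lam hγ hC hh (hit i) hβs ht hle k
          rwa [hfix] at this
        · have := dualMap_le_lam_of_le_smul hγ hC hh hβs ht hle k
          rwa [hfix] at this)
    exact ⟨h1.tendsto, h1, h2, h3⟩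
  · rw [hJ]; exact isStandardInterference_affine hG hb
  · rw [hJ]; exact hpfix
  · have h1 := (hlin p).tendsto
    simp only [Function.iterate_fixed hp] at h1
    exact tendsto_nhds_unique tendsto_const_nhds h1
  · obtain ⟨A, hA⟩ := exists_norm_iterate_affine_sub_le hρ hpfix hr
    exact ⟨A, fun p0 _ i => by rw [hJ]; exact hA p0 i⟩
  · exact add_nonneg (fun k => (hps k).le) zero_le_one
  · rw [hJ]; exact tendsto_norm_iterate_affine_sub hG hρ hpfix
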